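/- Let $d\in\mathbb N$, let $\mu\in\mathbb R^d$ be nonzero and let $\Sigma\in\mathbb R^{d\times d}$ be positive definite with $\|\mu\|^2=\|\Sigma\|$ (Euclidean norm and spectral norm). For $\kappa\in(0,\infty)$ let $\mathcal D_\kappa$ be the distribution of $(x,y)\in\mathbb R^d\times\{0,1\}$ in which $y$ is uniform on $\{0,1\}$, $x\mid y=1\sim N(\mu,\kappa^{-1}\Sigma)$ and $x\mid y=0\sim N(-\mu,\kappa^{-1}\Sigma)$. For a training set $S=\{(x_i,y_i)\}_{i=1}^n$ let $$\mathcal L_S(w)=\frac1n\sum_{i=1}^n\Bigl(y_i\,l(w^\top x_i)+(1-y_i)\,l(-w^\top x_i)\Bigr),\qquad l(z)=\log(1+e^{-z}),$$ be the empirical (ERM) loss, and let $\mathrm{sim}(u,v)=\frac{u^\top v}{\|u\|\,\|v\|}$ denote cosine similarity. Then for every $c>0$ there is $\kappa_0>0$, depending only on $c,d,\mu,\Sigma$, such that for all $\kappa\ge\kappa_0$, all $\epsilon,\delta\in(0,1)$ and all $n\in\mathbb N$ with $$n\ \ge\ \frac{\exp(c\kappa^2)}{\epsilon^4}\Bigl(1+\log\frac1\epsilon+\log\frac1\delta\Bigr)$$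 the following holds: if $S=\{(x_i,y_i)\}_{i=1}^n$ is drawn i.i.d. from $\mathcal D_\kappa$, then with probability at least $1-\delta$ the loss $\mathcal L_S$ has a unique minimizer $\hat w_S^*$ over $\mathbb R^d$, and $\mathrm{sim}(\hat w_S^*,\Sigma^{-1}\mu)\ge 1-\epsilon$. -/

import Mathlib

open MeasureTheory ProbabilityTheory Set

namespace ERM

/-- The logistic loss `l(z) = log (1 + exp (-z))`. -/
noncomputable def logisticLoss (z : ℝ) : ℝ := Real.log (1 + Real.exp (-z))

/-- A labelled example `(x, y)` with `x ∈ ℝᵈ` and `y ∈ {0, 1}`. -/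
abbrev Example (d : ℕ) : Type := EuclideanSpace ℝ (Fin d) × Fin 2

/-- The numerical value (`0` or `1`) of a label. -/
def labelValue (y : Fin 2) : ℝ := ((y : ℕ) : ℝ)

/-- The data distribution `D_κ`: the label `y` is uniform on `{0, 1}`, and `x` is
`N(μ, κ⁻¹ Σ)` given `y = 1` and `N(-μ, κ⁻¹ Σ)` given `y = 0`. -/
noncomputable def dataDist {d : ℕ} (μ : EuclideanSpace ℝ (Fin d)) (Cov : Matrix (Fin d) (Fin d) ℝ)
    (κ : ℝ) : Measure (Example d) :=
  (2⁻¹ : ENNReal) • (multivariateGaussian μ (κ⁻¹ • Cov)).prod (Measure.dirac (1 : Fin 2)) +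
    (2⁻¹ : ENNReal) • (multivariateGaussian (-μ) (κ⁻¹ • Cov)).prod (Measure.dirac (0 : Fin 2))

instance {d : ℕ} (μ : EuclideanSpace ℝ (Fin d)) (Cov : Matrix (Fin d) (Fin d) ℝ) (κ : ℝ) :
    IsProbabilityMeasure (dataDist μ Cov κ) := by
  constructor
  simp [dataDist, ENNReal.inv_two_add_inv_two]

/-- The law of a training set of `n` independent examples drawn from `D_κ`. -/
noncomputable def trainingDist {d : ℕ} (μ : EuclideanSpace ℝ (Fin d))
    (Cov : Matrix (Fin d) (Fin d) ℝ) (κ : ℝ) (n : ℕ) : Measure (Fin n → Example d) :=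
  Measure.pi fun _ => dataDist μ Cov κ

/-- The empirical (ERM) loss
`L_S(w) = (1/n) ∑ᵢ (yᵢ l(wᵀxᵢ) + (1 - yᵢ) l(-wᵀxᵢ))` of the training set `S`. -/
noncomputable def empiricalLoss {d n : ℕ} (S : Fin n → Example d)
    (w : EuclideanSpace ℝ (Fin d)) : ℝ :=
  (1 / (n : ℝ)) * ∑ i, (labelValue (S i).2 * logisticLoss (inner ℝ w (S i).1) +
    (1 - labelValue (S i).2) * logisticLoss (-inner ℝ w (S i).1))

/-- `w` is the unique global minimizer of `f`. -/
def IsUniqueMinimizer {E : Type*} (f : E → ℝ) (w : E) : Prop :=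
  IsMinOn f univ w ∧ ∀ v, IsMinOn f univ v → v = w

/-- Cosine similarity of two vectors. -/
noncomputable def cosSim {d : ℕ} (u v : EuclideanSpace ℝ (Fin d)) : ℝ :=
  inner ℝ u v / (‖u‖ * ‖v‖)

end ERM

namespace ERM

/-! Multiplying `x` by the sign of its label turns both classes into one Gaussian `ν = N(μ, κ⁻¹Σ)`,
and the empirical loss becomes the mean of `l(⟨w, z⟩)` over independent `z ∼ ν`. The population
gradient vanishes at `w₀ = 2κΣ⁻¹μ`. Indeed `⟨w₀, z⟩ ∼ N(a, 2a)`, whose density satisfies `p(-x) =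
p(x)e⁻ˣ`, so `x p(x) / (1 + eˣ)` is odd; and for `u ⊥ μ` the variable `⟨u, z⟩` is centred and
independent of `⟨w₀, z⟩` (`integral_inv_one_add_exp_inner_mul_inner`).

The empirical minimizer lies within `ε‖w₀‖` of `w₀` once the loss is strongly convex near `w₀` and
its gradient at `w₀` is smaller than the modulus times that radius
(`exists_isUniqueMinimizer_norm_sub_le`). Curvature comes from the sample points in a ball of radius
`R` independent of `κ`: there `|⟨w, z⟩| ≤ 2‖w₀‖R = O(κ)`, so the modulus is at least `e^{-O(κ)}`
times a multiple of `1/κ`, the order of the truncated second moments.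

Hence it suffices that `d` gradient coordinates and `d²` truncated moments are accurate to `s = a
e^{-bκ} ε`. A Chernoff bound with a constant free of `κ` (`one_sub_le_pi_forall_abs_sum_lt`) asks
for a multiple of `e^{2bκ} ε⁻² (1 + log(1/δ))` samples, which `exp(cκ²)` dominates for large `κ`,
however small `c` is. -/

/-! ### Convexity and curvature of the scalar logistic loss. -/

lemma hasDerivAt_logisticLoss (t : ℝ) :
    HasDerivAt logisticLoss (-(1 + Real.exp t)⁻¹) t := by
  have h : HasDerivAt (fun z : ℝ => 1 + Real.exp (-z)) (-Real.exp (-t)) t := by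
    simpa using ((hasDerivAt_neg t).exp).const_add 1
  have h' := h.log (by positivity)
  refine HasDerivAt.congr_deriv (f := logisticLoss) h' ?_
  rw [Real.exp_neg]
  have := Real.exp_pos t
  field_simp
  ring

lemma hasDerivAt_neg_inv_one_add_exp (t : ℝ) :
    HasDerivAt (fun z : ℝ => -(1 + Real.exp z)⁻¹) (Real.exp t / (1 + Real.exp t) ^ 2) t := by
  have h : HasDerivAt (fun z : ℝ => 1 + Real.exp z) (Real.exp t) t := by
    simpa using (Real.hasDerivAt_exp t).const_add 1
  have h' := (h.inv (by positivity)).neg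
  refine HasDerivAt.congr_deriv (f := fun z : ℝ => -(1 + Real.exp z)⁻¹) h' ?_
  ring

/-- The second derivative is even, and `1 + eˢ ≤ 2eˢ` for `s ≥ 0`. -/
lemma exp_neg_abs_div_four_le (t : ℝ) :
    Real.exp (-|t|) / 4 ≤ Real.exp t / (1 + Real.exp t) ^ 2 := by
  have key : ∀ s : ℝ, 0 ≤ s → Real.exp (-s) / 4 ≤ Real.exp s / (1 + Real.exp s) ^ 2 := by
    intro s hs
    have h1 : 1 ≤ Real.exp s := Real.one_le_exp hs
    rw [Real.exp_neg, div_le_div_iff₀ (by norm_num) (by positivity)]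
    rw [inv_mul_le_iff₀ (by positivity)]
    nlinarith
  rcases le_total 0 t with h | h
  · rw [abs_of_nonneg h]; exact key t h
  · rw [abs_of_nonpos h]
    refine (key (-t) (by linarith)).trans (le_of_eq ?_)
    rw [Real.exp_neg]
    have := Real.exp_pos t
    field_simp
    ring

/-- Tangent line bound for a function with second derivative bounded below. -/
lemma tangent_add_sq_le {f f' f'' : ℝ → ℝ} (hf : ∀ t, HasDerivAt f (f' t) t)
    (hf' : ∀ t, HasDerivAt f' (f'' t) t) {s : Set ℝ} (hs : Convex ℝ s) {m : ℝ}
    (hm : ∀ t ∈ s, m ≤ f'' t) {a b : ℝ} (ha : a ∈ s) (hb : b ∈ s) :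
    f a + f' a * (b - a) + m / 2 * (b - a) ^ 2 ≤ f b := by
  -- Subtracting `m t² / 2` turns the curvature bound into plain convexity.
  have hg : ∀ t, HasDerivAt (fun t => f t - m / 2 * t ^ 2) (f' t - m * t) t := fun t => by
    refine HasDerivAt.congr_deriv (f := fun t => f t - m / 2 * t ^ 2)
      ((hf t).sub ((hasDerivAt_pow 2 t).const_mul (m / 2))) ?_
    norm_num; ring
  have hg' : ∀ t, HasDerivAt (fun t => f' t - m * t) (f'' t - m) t := fun t => by
    refine HasDerivAt.congr_deriv (f := fun t => f' t - m * t)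
      ((hf' t).sub ((hasDerivAt_id t).const_mul m)) ?_
    ring
  have hconv : ConvexOn ℝ s (fun t => f t - m / 2 * t ^ 2) := by
    refine convexOn_of_hasDerivWithinAt2_nonneg hs
      (fun t _ => (hg t).continuousAt.continuousWithinAt)
      (fun t _ => (hg t).hasDerivWithinAt) (fun t _ => (hg' t).hasDerivWithinAt) ?_
    intro t ht
    linarith [hm t (interior_subset ht)]
  have key : (f' a - m * a) * (b - a) ≤ (f b - m / 2 * b ^ 2) - (f a - m / 2 * a ^ 2) := by
    rcases lt_trichotomy a b with h | h | h
    · have := hconv.le_slope_of_hasDerivAt ha hb h (hg a)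
      rw [slope_def_field, le_div_iff₀ (by linarith)] at this
      exact this
    · subst h; simp
    · have := hconv.slope_le_of_hasDerivAt hb ha h (hg a)
      rw [slope_def_field, div_le_iff₀ (by linarith)] at this
      linarith
  nlinarith

lemma logisticLoss_tangent_le (a b : ℝ) :
    logisticLoss a + -(1 + Real.exp a)⁻¹ * (b - a) ≤ logisticLoss b := by
  have := tangent_add_sq_le hasDerivAt_logisticLoss hasDerivAt_neg_inv_one_add_exp convex_univ
    (m := 0) (fun t _ => by positivity) (mem_univ a) (mem_univ b)
  linarith

lemma logisticLoss_tangent_add_sq_le {a b B : ℝ} (ha : |a| ≤ B) (hb : |b| ≤ B) :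
    logisticLoss a + -(1 + Real.exp a)⁻¹ * (b - a) + Real.exp (-B) / 8 * (b - a) ^ 2
      ≤ logisticLoss b := by
  have := tangent_add_sq_le hasDerivAt_logisticLoss hasDerivAt_neg_inv_one_add_exp
    (convex_Icc (-B) B) (m := Real.exp (-B) / 4)
    (fun t ht => le_trans (by gcongr; exact abs_le.2 ht) (exp_neg_abs_div_four_le t))
    (abs_le.1 ha) (abs_le.1 hb)
  linarith

lemma continuous_logisticLoss : Continuous logisticLoss :=
  continuous_iff_continuousAt.2 fun t => (hasDerivAt_logisticLoss t).continuousAt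

lemma convexOn_logisticLoss : ConvexOn ℝ univ logisticLoss :=
  convexOn_of_hasDerivWithinAt2_nonneg convex_univ continuous_logisticLoss.continuousOn
    (fun t _ => (hasDerivAt_logisticLoss t).hasDerivWithinAt)
    (fun t _ => (hasDerivAt_neg_inv_one_add_exp t).hasDerivWithinAt) (fun t _ => by positivity)

/-! ### Localizing a minimizer, and its angle to the target. -/

/-- A continuous convex function which is strongly convex on a ball, and whose gradient at a point
`w₀` is small, has a unique minimizer, which is close to `w₀`. -/
lemma exists_isUniqueMinimizer_norm_sub_le {V : Type*} [NormedAddCommGroup V]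
    [InnerProductSpace ℝ V] [ProperSpace V] {f : V → ℝ} {G : V → V} {W β r : ℝ} {w₀ : V}
    (hcont : Continuous f) (hconv : ConvexOn ℝ univ f) (hβ : 0 < β) (hr : 0 < r)
    (hq : ∀ u v, ‖u‖ ≤ W → ‖v‖ ≤ W → f u + inner ℝ (G u) (v - u) + β * ‖v - u‖ ^ 2 ≤ f v)
    (hW : ‖w₀‖ + r ≤ W) (hG : ‖G w₀‖ < β * r) :
    ∃ w, IsUniqueMinimizer f w ∧ ‖w - w₀‖ ≤ r := by
  have hball : ∀ v, ‖v - w₀‖ ≤ r → ‖v‖ ≤ W := fun v hv => by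
    have := norm_le_norm_add_norm_sub' v w₀
    linarith
  have hw₀ : ‖w₀‖ ≤ W := hball w₀ (by simp [hr.le])
  -- On the sphere the gain `β r²` beats the linear loss `‖G w₀‖ r`.
  have hsphere : ∀ v, ‖v - w₀‖ = r → f w₀ < f v := fun v hv => by
    have h1 := hq w₀ v hw₀ (hball v hv.le)
    have h2 := neg_le_of_abs_le (abs_real_inner_le_norm (G w₀) (v - w₀))
    rw [hv] at h1 h2
    nlinarith
  -- The segment from `w₀` to a farther point crosses the sphere, so convexity carries the strict
  -- inequality outwards.
  have hout : ∀ v, r < ‖v - w₀‖ → f w₀ < f v := fun v hv => by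
    by_contra! hle
    set t := r / ‖v - w₀‖ with ht
    have hpos : 0 < ‖v - w₀‖ := hr.trans hv
    have ht0 : 0 < t := by positivity
    have ht1 : t ≤ 1 := by rw [ht, div_le_one hpos]; exact hv.le
    have h1 := hconv.2 (mem_univ w₀) (mem_univ v) (show 0 ≤ 1 - t by linarith) ht0.le
      (by ring)
    have h2 := hsphere ((1 - t) • w₀ + t • v) (by
      rw [show (1 - t) • w₀ + t • v - w₀ = t • (v - w₀) by module, norm_smul,
        Real.norm_of_nonneg ht0.le, ht, div_mul_cancel₀ _ hpos.ne'])
    simp only [smul_eq_mul] at h1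
    nlinarith
  obtain ⟨w, hwmem, hwmin⟩ := (isCompact_closedBall w₀ r).exists_isMinOn
    ⟨w₀, Metric.mem_closedBall_self hr.le⟩ hcont.continuousOn
  rw [mem_closedBall_iff_norm] at hwmem
  have hww₀ : f w ≤ f w₀ := hwmin (Metric.mem_closedBall_self hr.le)
  have hglob : ∀ v, f w ≤ f v := fun v => by
    rcases le_or_gt ‖v - w₀‖ r with h | h
    · exact hwmin (mem_closedBall_iff_norm.2 h)
    · exact hww₀.trans (hout v h).le
  refine ⟨w, ⟨fun v _ => hglob v, fun v hv => ?_⟩, hwmem⟩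
  have hvw : f v = f w := le_antisymm (hv (mem_univ w)) (hglob v)
  have hv' : ‖v - w₀‖ ≤ r := by
    by_contra! h
    linarith [hout v h]
  -- Expanding at the midpoint of two minimizers, the gradient terms cancel in the sum and only the
  -- quadratic gain remains.
  set p := (1 / 2 : ℝ) • (v + w) with hp
  have hpW : ‖p‖ ≤ W := by
    rw [hp, norm_smul]
    have := norm_add_le v w
    have := hball v hv'
    have := hball w hwmem
    norm_num
    linarith
  have h1 := hq p v hpW (hball v hv')
  have h2 := hq p w hpW (hball w hwmem)
  rw [show v - p = (1 / 2 : ℝ) • (v - w) by rw [hp]; module] at h1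
  rw [show w - p = -((1 / 2 : ℝ) • (v - w)) by rw [hp]; module, inner_neg_right, norm_neg] at h2
  have h3 := hglob p
  have h4 : β * ‖(1 / 2 : ℝ) • (v - w)‖ ^ 2 ≤ 0 := by linarith
  have h5 : ‖(1 / 2 : ℝ) • (v - w)‖ ^ 2 ≤ 0 := nonpos_of_mul_nonpos_right h4 hβ
  have h6 : ‖(1 / 2 : ℝ) • (v - w)‖ = 0 := by
    have := sq_nonneg ‖(1 / 2 : ℝ) • (v - w)‖
    exact pow_eq_zero_iff (two_ne_zero) |>.1 (le_antisymm h5 this)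
  simpa [sub_eq_zero] using h6

/-- With `x = c‖u‖`, squaring the hypothesis gives `2c⟨w, u⟩ ≥ ‖w‖² + (1 - ε²)x²`. Since `1 - ε² ≥
(1 - ε)²`, this is at least `2(1 - ε)‖w‖x`. The condition `ε < 1` keeps `w` away from `0`. -/
lemma one_sub_le_cosSim {d : ℕ} {w u : EuclideanSpace ℝ (Fin d)} {c ε : ℝ} (hc : 0 < c)
    (hu : u ≠ 0) (hε : 0 < ε) (hε1 : ε < 1) (h : ‖w - c • u‖ ≤ ε * ‖c • u‖) :
    1 - ε ≤ cosSim w u := by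
  have hcu : ‖c • u‖ = c * ‖u‖ := by rw [norm_smul, Real.norm_of_nonneg hc.le]
  have hupos : 0 < ‖u‖ := norm_pos_iff.2 hu
  have hwpos : 0 < ‖w‖ := by
    have h1 := norm_le_norm_add_norm_sub' (c • u) w
    rw [norm_sub_rev, hcu] at h1
    rw [hcu] at h
    nlinarith [mul_pos hc hupos]
  have h2 : ‖w - c • u‖ ^ 2 ≤ (ε * (c * ‖u‖)) ^ 2 := by
    rw [hcu] at h
    gcongr
  rw [norm_sub_sq_real, hcu, inner_smul_right] at h2
  rw [cosSim, le_div_iff₀ (by positivity)]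
  have hx := mul_pos hc hupos
  have h3 : c * ((1 - ε) * (‖w‖ * ‖u‖)) ≤ c * inner ℝ w u := by
    have : 0 ≤ (ε * (1 - ε)) * (c * ‖u‖) ^ 2 := by
      have : 0 ≤ 1 - ε := by linarith
      positivity
    nlinarith [sq_nonneg (‖w‖ - (1 - ε) * (c * ‖u‖))]
  exact le_of_mul_le_mul_left h3 hc

/-! ### The empirical loss through signed examples. -/

section SignedPoint

variable {d n : ℕ}

/-- The example `x` with the sign of its label: `x` if `y = 1` and `-x` if `y = 0`. -/
noncomputable def signedPoint (p : Example d) : EuclideanSpace ℝ (Fin d) :=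
  (2 * labelValue p.2 - 1) • p.1

lemma empiricalLoss_eq (S : Fin n → Example d) (w : EuclideanSpace ℝ (Fin d)) :
    empiricalLoss S w = (1 / (n : ℝ)) * ∑ i, logisticLoss (inner ℝ w (signedPoint (S i))) := by
  unfold empiricalLoss
  congr 1
  refine Finset.sum_congr rfl fun i _ => ?_
  obtain ⟨x, y⟩ := S i
  fin_cases y
  · simp [signedPoint, labelValue]
  · norm_num [signedPoint, labelValue]

lemma continuous_empiricalLoss (S : Fin n → Example d) : Continuous (empiricalLoss S) := by
  have : empiricalLoss S = _ := funext (empiricalLoss_eq S)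
  rw [this]
  have := continuous_logisticLoss
  fun_prop

lemma convexOn_empiricalLoss (S : Fin n → Example d) : ConvexOn ℝ univ (empiricalLoss S) := by
  refine ⟨convex_univ, fun u _ v _ a b ha hb hab => ?_⟩
  simp only [empiricalLoss_eq, smul_eq_mul]
  have : ∑ i, logisticLoss (inner ℝ (a • u + b • v) (signedPoint (S i))) ≤
      ∑ i, (a * logisticLoss (inner ℝ u (signedPoint (S i)))
        + b * logisticLoss (inner ℝ v (signedPoint (S i)))) := by
    refine Finset.sum_le_sum fun i _ => ?_
    rw [inner_add_left, real_inner_smul_left, real_inner_smul_left]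
    exact convexOn_logisticLoss.2 (mem_univ _) (mem_univ _) ha hb hab
  rw [Finset.sum_add_distrib, ← Finset.mul_sum, ← Finset.mul_sum] at this
  calc _ ≤ _ := mul_le_mul_of_nonneg_left this (by positivity)
    _ = _ := by ring

/-- The gradient of the empirical loss. -/
noncomputable def empiricalGradient (S : Fin n → Example d) (w : EuclideanSpace ℝ (Fin d)) :
    EuclideanSpace ℝ (Fin d) :=
  (1 / (n : ℝ)) • ∑ i, (-(1 + Real.exp (inner ℝ w (signedPoint (S i))))⁻¹) • signedPoint (S i)

/-- Points in the ball have both inner products bounded by `W * R`, where the curvature is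
controlled; the other points contribute only their tangent line. -/
lemma empiricalLoss_tangent_add_sq_le (S : Fin n → Example d) {W R : ℝ}
    {u v : EuclideanSpace ℝ (Fin d)} (hu : ‖u‖ ≤ W) (hv : ‖v‖ ≤ W) :
    empiricalLoss S u + inner ℝ (empiricalGradient S u) (v - u) +
      Real.exp (-(W * R)) / 8 * ((1 / (n : ℝ)) * ∑ i, (Metric.closedBall 0 R).indicator
        (fun z => (inner ℝ (v - u) z) ^ 2) (signedPoint (S i))) ≤ empiricalLoss S v := by
  simp only [empiricalLoss_eq, empiricalGradient, real_inner_smul_left, sum_inner]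
  rw [mul_left_comm, ← mul_add, ← mul_add, Finset.mul_sum, ← Finset.sum_add_distrib,
    ← Finset.sum_add_distrib]
  refine mul_le_mul_of_nonneg_left (Finset.sum_le_sum fun i _ => ?_) (by positivity)
  set z := signedPoint (S i)
  have hsub : inner ℝ z (v - u) = inner ℝ v z - inner ℝ u z := by
    rw [inner_sub_right, real_inner_comm, real_inner_comm z u]
  have hW : 0 ≤ W := (norm_nonneg u).trans hu
  by_cases hz : z ∈ Metric.closedBall 0 R
  · rw [indicator_of_mem hz, hsub, inner_sub_left]
    rw [mem_closedBall_zero_iff] at hz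
    exact logisticLoss_tangent_add_sq_le
      ((abs_real_inner_le_norm u z).trans (mul_le_mul hu hz (norm_nonneg _) hW))
      ((abs_real_inner_le_norm v z).trans (mul_le_mul hv hz (norm_nonneg _) hW))
  · rw [indicator_of_notMem hz, hsub, mul_zero, add_zero]
    exact logisticLoss_tangent_le _ _

end SignedPoint

/-! ### Exponential moments and Chernoff bounds. -/

/-- The second-order Taylor remainder is dominated by `t²` times an envelope independent of `t`, so
a single exponential moment controls the moment generating function on `[0, 1]`. -/
lemma exp_mul_le_one_add_add {t x : ℝ} (ht : 0 ≤ t) (ht1 : t ≤ 1) :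
    Real.exp (t * x) ≤ 1 + t * x + 2 * t ^ 2 * Real.exp (2 * |x|) := by
  have h1 : |Real.exp (t * x) - (1 + t * x)| ≤ |t * x| ^ 2 * Real.exp |t * x| := by
    have := Complex.norm_exp_sub_sum_le_norm_mul_exp ((t * x : ℝ) : ℂ) 2
    rw [show Complex.exp ((t * x : ℝ) : ℂ) - ∑ m ∈ Finset.range 2,
        ((t * x : ℝ) : ℂ) ^ m / (m.factorial : ℂ) = ((Real.exp (t * x) - (1 + t * x) : ℝ) : ℂ) by
      simp [Finset.sum_range_succ], Complex.norm_real, Complex.norm_real] at this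
    exact this
  have h2 : |t * x| ≤ |x| := by
    rw [abs_mul, abs_of_nonneg ht]
    exact mul_le_of_le_one_left (abs_nonneg x) ht1
  have h3 : |x| ^ 2 ≤ 2 * Real.exp |x| := by
    have := Real.quadratic_le_exp_of_nonneg (abs_nonneg x)
    nlinarith [abs_nonneg x]
  have h4 : |t * x| ^ 2 * Real.exp |t * x| ≤ t ^ 2 * (2 * Real.exp |x| * Real.exp |x|) := by
    rw [abs_mul, mul_pow, sq_abs t, mul_assoc, ← abs_mul]
    gcongr
  rw [mul_assoc 2, ← Real.exp_add, ← two_mul] at h4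
  linarith [le_abs_self (Real.exp (t * x) - (1 + t * x))]

lemma integrable_of_integrable_exp_abs {Ω : Type*} [MeasurableSpace Ω] {P : Measure Ω} {X : Ω → ℝ}
    (hX : AEStronglyMeasurable X P)
    (hint : Integrable (fun ω => Real.exp (2 * |X ω|)) P) : Integrable X P := by
  refine hint.mono' hX (ae_of_all _ fun ω => ?_)
  have := Real.add_one_le_exp (2 * |X ω|)
  have := abs_nonneg (X ω)
  rw [Real.norm_eq_abs]
  linarith

lemma integrable_exp_mul_of_integrable_exp_abs {Ω : Type*} [MeasurableSpace Ω] {P : Measure Ω}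
    {X : Ω → ℝ} (hX : AEStronglyMeasurable X P)
    (hint : Integrable (fun ω => Real.exp (2 * |X ω|)) P) {t : ℝ} (ht : 0 ≤ t) (ht1 : t ≤ 1) :
    Integrable (fun ω => Real.exp (t * X ω)) P := by
  refine hint.mono' (Real.continuous_exp.comp_aestronglyMeasurable (hX.const_mul t))
    (ae_of_all _ fun ω => ?_)
  rw [Real.norm_of_nonneg (Real.exp_pos _).le]
  refine Real.exp_le_exp.2 ?_
  nlinarith [abs_nonneg (X ω), mul_le_mul_of_nonneg_left (le_abs_self (X ω)) ht,
    mul_nonneg (sub_nonneg.2 ht1) (abs_nonneg (X ω))]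

section Chernoff

variable {Ω : Type*} [MeasurableSpace Ω] {P : Measure Ω} [IsProbabilityMeasure P] {X : Ω → ℝ}
  {C : ℝ}

lemma mgf_le_of_integral_exp_abs_le (hX : AEStronglyMeasurable X P)
    (hint : Integrable (fun ω => Real.exp (2 * |X ω|)) P)
    (hC : ∫ ω, Real.exp (2 * |X ω|) ∂P ≤ C) (h0 : ∫ ω, X ω ∂P = 0) {t : ℝ} (ht : 0 ≤ t)
    (ht1 : t ≤ 1) : mgf X P t ≤ Real.exp (2 * t ^ 2 * C) := by
  have hXi := integrable_of_integrable_exp_abs hX hint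
  calc mgf X P t ≤ ∫ ω, (1 + t * X ω + 2 * t ^ 2 * Real.exp (2 * |X ω|)) ∂P :=
        integral_mono (integrable_exp_mul_of_integrable_exp_abs hX hint ht ht1)
          (((integrable_const _).add (hXi.const_mul t)).add (hint.const_mul _))
          fun ω => exp_mul_le_one_add_add ht ht1
    _ = 1 + 2 * t ^ 2 * ∫ ω, Real.exp (2 * |X ω|) ∂P := by
        rw [integral_add (f := fun ω => 1 + t * X ω) ((integrable_const _).add (hXi.const_mul t))
            (hint.const_mul _),
          integral_add (integrable_const _) (hXi.const_mul t), integral_const_mul,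
          integral_const_mul, h0]
        simp
    _ ≤ 1 + 2 * t ^ 2 * C := by gcongr
    _ ≤ _ := by linarith [Real.add_one_le_exp (2 * t ^ 2 * C)]

/-- A Bernstein-type bound on the upper tail of a sum of independent centred variables. -/
lemma pi_measureReal_sum_ge_le (hX : AEStronglyMeasurable X P)
    (hint : Integrable (fun ω => Real.exp (2 * |X ω|)) P)
    (hC : ∫ ω, Real.exp (2 * |X ω|) ∂P ≤ C) (h0 : ∫ ω, X ω ∂P = 0) (hCpos : 0 < C) {s : ℝ}
    (hs : 0 ≤ s) (hsC : s ≤ 4 * C) (n : ℕ) :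
    (Measure.pi fun _ : Fin n => P).real {S | n * s ≤ ∑ i, X (S i)} ≤
      Real.exp (-(n * s ^ 2 / (8 * C))) := by
  -- This `t` minimizes the exponent `-ts + 2t²C`; `s ≤ 4C` ensures `t ≤ 1`.
  set t := s / (4 * C) with htdef
  have ht : 0 ≤ t := by positivity
  have ht1 : t ≤ 1 := by rw [htdef, div_le_one (by positivity)]; exact hsC
  have hexp := integrable_exp_mul_of_integrable_exp_abs hX hint ht ht1
  have hprod : ∀ S : Fin n → Ω, Real.exp (t * ∑ i, X (S i)) = ∏ i, Real.exp (t * X (S i)) :=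
    fun S => by rw [Finset.mul_sum, Real.exp_sum]
  have hmgf : mgf (fun S : Fin n → Ω => ∑ i, X (S i)) (Measure.pi fun _ => P) t
      = mgf X P t ^ n := by
    simp only [mgf, hprod]
    rw [integral_fintype_prod_eq_pow (fun ω => Real.exp (t * X ω)), Fintype.card_fin]
  have hint' : Integrable (fun S : Fin n → Ω => Real.exp (t * ∑ i, X (S i)))
      (Measure.pi fun _ => P) := by
    simp only [hprod]
    exact Integrable.fintype_prod (f := fun _ ω => Real.exp (t * X ω)) fun _ => hexp
  refine (measure_ge_le_exp_mul_mgf (n * s) ht hint').trans ?_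
  rw [hmgf]
  calc Real.exp (-t * (n * s)) * mgf X P t ^ n
      ≤ Real.exp (-t * (n * s)) * Real.exp (2 * t ^ 2 * C) ^ n := by
        gcongr
        · exact mgf_nonneg
        · exact mgf_le_of_integral_exp_abs_le hX hint hC h0 ht ht1
    _ = Real.exp (-(n * s ^ 2 / (8 * C))) := by
        rw [← Real.exp_nat_mul, ← Real.exp_add]
        congr 1
        rw [htdef]
        field_simp
        ring

lemma pi_measureReal_abs_sum_ge_le (hX : AEStronglyMeasurable X P)
    (hint : Integrable (fun ω => Real.exp (2 * |X ω|)) P)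
    (hC : ∫ ω, Real.exp (2 * |X ω|) ∂P ≤ C) (h0 : ∫ ω, X ω ∂P = 0) (hCpos : 0 < C) {s : ℝ}
    (hs : 0 ≤ s) (hsC : s ≤ 4 * C) (n : ℕ) :
    (Measure.pi fun _ : Fin n => P).real {S | n * s ≤ |∑ i, X (S i)|} ≤
      2 * Real.exp (-(n * s ^ 2 / (8 * C))) := by
  have h1 := pi_measureReal_sum_ge_le hX hint hC h0 hCpos hs hsC n
  have h2 := pi_measureReal_sum_ge_le (X := fun ω => -X ω) hX.neg (by simpa using hint)
    (by simpa using hC) (by simp [integral_neg, h0]) hCpos hs hsC n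
  have hsub : {S : Fin n → Ω | n * s ≤ |∑ i, X (S i)|} ⊆
      {S | n * s ≤ ∑ i, X (S i)} ∪ {S | n * s ≤ ∑ i, -X (S i)} := fun S hS => by
    simpa [le_abs] using hS
  have := (measureReal_mono (μ := Measure.pi fun _ : Fin n => P) hsub).trans
    (measureReal_union_le _ _)
  linarith

/-- Simultaneous concentration of finitely many empirical means. -/
lemma one_sub_le_pi_forall_abs_sum_lt {ι : Type*} [Fintype ι] {X : ι → Ω → ℝ}
    (hX : ∀ k, Measurable (X k))
    (hint : ∀ k, Integrable (fun ω => Real.exp (2 * |X k ω|)) P)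
    (hC : ∀ k, ∫ ω, Real.exp (2 * |X k ω|) ∂P ≤ C) (h0 : ∀ k, ∫ ω, X k ω ∂P = 0)
    (hCpos : 0 < C) {s : ℝ} (hs : 0 ≤ s) (hsC : s ≤ 4 * C) (n : ℕ) :
    MeasurableSet {S : Fin n → Ω | ∀ k, |∑ i, X k (S i)| < n * s} ∧
    ENNReal.ofReal (1 - 2 * Fintype.card ι * Real.exp (-(n * s ^ 2 / (8 * C)))) ≤
      (Measure.pi fun _ : Fin n => P) {S | ∀ k, |∑ i, X k (S i)| < n * s} := by
  have hmeas : MeasurableSet {S : Fin n → Ω | ∀ k, |∑ i, X k (S i)| < n * s} := by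
    simp only [ofPred_forall]
    refine MeasurableSet.iInter fun k => measurableSet_lt ?_ measurable_const
    have := hX k
    fun_prop
  refine ⟨hmeas, ?_⟩
  have hcompl : (Measure.pi fun _ : Fin n => P).real
      {S | ∀ k, |∑ i, X k (S i)| < n * s}ᶜ ≤
        2 * Fintype.card ι * Real.exp (-(n * s ^ 2 / (8 * C))) := by
    have : {S : Fin n → Ω | ∀ k, |∑ i, X k (S i)| < n * s}ᶜ =
        ⋃ k, {S | n * s ≤ |∑ i, X k (S i)|} := by
      ext S; simp
    rw [this]
    refine (measureReal_iUnion_fintype_le _).trans ?_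
    refine (Finset.sum_le_sum fun k _ => pi_measureReal_abs_sum_ge_le
      (hX k).aestronglyMeasurable (hint k) (hC k) (h0 k) hCpos hs hsC n).trans ?_
    rw [Finset.sum_const, Finset.card_univ, nsmul_eq_mul]
    exact le_of_eq (by ring)
  rw [probReal_compl_eq_one_sub hmeas] at hcompl
  refine ENNReal.ofReal_le_of_le_toReal ?_
  rw [← measureReal_def]
  linarith

end Chernoff

/-! ### The scalar first-order condition and tail inequalities. -/

/-- For `U ∼ N(a, 2a)` the variable `U / (1 + exp U)` is centred. -/
lemma integral_inv_one_add_exp_mul_gaussianReal {a : ℝ} (ha : 0 < a) :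
    ∫ x, (1 + Real.exp x)⁻¹ * x ∂(gaussianReal a (2 * a).toNNReal) = 0 := by
  rw [integral_gaussianReal_eq_integral_smul (by simpa using ha)]
  set F : ℝ → ℝ := fun x => gaussianPDFReal a (2 * a).toNNReal x • ((1 + Real.exp x)⁻¹ * x) with hF
  have hodd : ∀ x, F (-x) = -F x := fun x => by
    -- Variance twice the mean gives `(x + a)² / (4a) = (x - a)² / (4a) + x`.
    have h : gaussianPDFReal a (2 * a).toNNReal (-x) =
        gaussianPDFReal a (2 * a).toNNReal x * Real.exp (-x) := by
      rw [gaussianPDFReal, gaussianPDFReal, mul_assoc _ (Real.exp _) (Real.exp _), ← Real.exp_add,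
        Real.coe_toNNReal _ (by positivity)]
      congr 2
      field_simp
      ring
    simp only [hF, smul_eq_mul, h, Real.exp_neg]
    have := Real.exp_pos x
    field_simp
    ring
  have h := integral_neg_eq_self F volume
  simp only [hodd, integral_neg] at h
  linarith

lemma inv_one_add_exp_mem_Icc (x : ℝ) : (1 + Real.exp x)⁻¹ ∈ Icc (0 : ℝ) 1 :=
  ⟨by positivity, inv_le_one_of_one_le₀ (by linarith [Real.exp_pos x])⟩

lemma exp_mul_abs_le (t x : ℝ) :
    Real.exp (t * |x|) ≤ Real.exp (t * x) + Real.exp (-t * x) := by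
  rcases abs_cases x with ⟨h, -⟩ | ⟨h, -⟩ <;> rw [h]
  · linarith [Real.exp_pos (-t * x)]
  · rw [mul_neg, ← neg_mul]; linarith [Real.exp_pos (t * x)]

lemma pow_four_le_exp_mul_abs {t : ℝ} (ht : 0 < t) (x : ℝ) :
    x ^ 4 ≤ 24 / t ^ 4 * Real.exp (t * |x|) := by
  have h := Real.pow_div_factorial_le_exp (t * |x|) (by positivity) 4
  rw [mul_pow, Even.pow_abs ⟨2, rfl⟩, div_le_iff₀ (by positivity)] at h
  norm_num [Nat.factorial] at h
  rw [div_mul_eq_mul_div, le_div_iff₀ (by positivity)]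
  linarith

section InnerProductSpace

variable {V : Type*} [NormedAddCommGroup V] [InnerProductSpace ℝ V]

lemma exp_mul_abs_inner_le (v z m : V) {t : ℝ} (ht : 0 ≤ t) :
    Real.exp (t * |inner ℝ v z|) ≤ Real.exp (t * |inner ℝ v m|) *
      Real.exp (t * |inner ℝ v z - inner ℝ v m|) := by
  rw [← Real.exp_add, ← mul_add]
  refine Real.exp_le_exp.2 (mul_le_mul_of_nonneg_left ?_ ht)
  have := abs_add_le (inner ℝ v m) (inner ℝ v z - inner ℝ v m)
  rwa [add_sub_cancel] at this

/-- Outside the ball `‖z‖ > R ≥ 2‖m‖`, so `‖z - m‖ ≥ ‖z‖ / 2` and `R²‖z‖² ≤ ‖z‖⁴ ≤ 16‖z - m‖⁴`.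
Cauchy–Schwarz over the basis then reduces the tail to one-dimensional fourth central moments. -/
lemma sq_inner_le_indicator_add {ι : Type*} [Fintype ι] (b : OrthonormalBasis ι ℝ V) {m : V}
    {R : ℝ} (hR : 0 < R) (hm : 2 * ‖m‖ ≤ R) (v z : V) :
    (inner ℝ v z) ^ 2 ≤ (Metric.closedBall 0 R).indicator (fun z => (inner ℝ v z) ^ 2) z +
      ‖v‖ ^ 2 * (16 * Fintype.card ι / R ^ 2) * ∑ i, (inner ℝ (b i) z - inner ℝ (b i) m) ^ 4 := by
  have hsum : 0 ≤ ∑ i, (inner ℝ (b i) z - inner ℝ (b i) m) ^ 4 :=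
    Finset.sum_nonneg fun i _ => by positivity
  by_cases hz : z ∈ Metric.closedBall 0 R
  · rw [indicator_of_mem hz]
    have : 0 ≤ ‖v‖ ^ 2 * (16 * Fintype.card ι / R ^ 2) := by positivity
    linarith [mul_nonneg this hsum]
  · rw [indicator_of_notMem hz, zero_add]
    rw [mem_closedBall_zero_iff, not_le] at hz
    have h1 : (inner ℝ v z) ^ 2 ≤ ‖v‖ ^ 2 * ‖z‖ ^ 2 := by
      rw [← sq_abs, ← mul_pow]
      gcongr
      exact abs_real_inner_le_norm v z
    have h2 : ‖z - m‖ ^ 4 ≤ Fintype.card ι * ∑ i, (inner ℝ (b i) z - inner ℝ (b i) m) ^ 4 := by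
      have := sq_sum_le_card_mul_sum_sq (s := Finset.univ) (f := fun i => inner ℝ (b i) (z - m) ^ 2)
      rw [b.sum_sq_inner_right] at this
      simpa only [inner_sub_right, ← pow_mul, Finset.card_univ] using this
    have h3 : ‖z‖ / 2 ≤ ‖z - m‖ := by
      have := norm_le_norm_add_norm_sub' z m
      linarith
    have h4 : (‖z‖ / 2) ^ 4 ≤ ‖z - m‖ ^ 4 := by gcongr
    have h5 : R ^ 2 * ‖z‖ ^ 2 ≤ 16 * ‖z - m‖ ^ 4 := by
      have : R ^ 2 ≤ ‖z‖ ^ 2 := by gcongr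
      nlinarith [sq_nonneg ‖z‖]
    have h6 : ‖z‖ ^ 2 ≤ 16 / R ^ 2 *
        (Fintype.card ι * ∑ i, (inner ℝ (b i) z - inner ℝ (b i) m) ^ 4) := by
      rw [div_mul_eq_mul_div, le_div_iff₀ (by positivity)]
      linarith
    calc _ ≤ _ := h1
      _ ≤ _ := mul_le_mul_of_nonneg_left h6 (by positivity)
      _ = _ := by ring

end InnerProductSpace

/-! ### Gaussian measures: stationarity and moment bounds. -/

section Gaussian

variable {V : Type*} [NormedAddCommGroup V] [InnerProductSpace ℝ V] [MeasurableSpace V]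
  [BorelSpace V] {ν : Measure V} [IsGaussian ν]

lemma integrable_inner_gaussian (v : V) : Integrable (fun z => inner ℝ v z) ν :=
  IsGaussian.integrable_dual ν (innerSL ℝ v)

lemma integrable_inner_mul_inner (u v : V) :
    Integrable (fun z => inner ℝ u z * inner ℝ v z) ν :=
  (IsGaussian.memLp_dual ν (innerSL ℝ u) 2 (by simp)).integrable_mul
    (IsGaussian.memLp_dual ν (innerSL ℝ v) 2 (by simp))

variable [SecondCountableTopology V] [CompleteSpace V]

lemma map_inner_eq_gaussianReal (v : V) :
    ν.map (fun z => inner ℝ v z) =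
      gaussianReal (inner ℝ v (∫ z, z ∂ν)) (covarianceBilin ν v v).toNNReal := by
  have h := IsGaussian.map_eq_gaussianReal (μ := ν) (innerSL ℝ v)
  rw [IsGaussian.integral_dual] at h
  rw [covarianceBilin_self IsGaussian.memLp_two_id]
  exact h

lemma integral_inner_gaussian (v : V) : ∫ z, inner ℝ v z ∂ν = inner ℝ v (∫ z, z ∂ν) :=
  IsGaussian.integral_dual (μ := ν) (innerSL ℝ v)

/-- The gradient of the population logistic loss of the Gaussian `ν` vanishes at `w` when the
covariance of `ν` maps `w` to twice the mean. -/
lemma integral_inv_one_add_exp_inner_mul_inner {w : V}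
    (hw : ∀ v, covarianceBilin ν w v = 2 * inner ℝ v (∫ z, z ∂ν))
    (hpos : 0 < inner ℝ w (∫ z, z ∂ν)) (v : V) :
    ∫ z, (1 + Real.exp (inner ℝ w z))⁻¹ * inner ℝ v z ∂ν = 0 := by
  set m := ∫ z, z ∂ν
  set a : ℝ := inner ℝ w m with ha
  -- Removing this multiple of `w` makes `u` orthogonal to the mean, hence by `hw` uncorrelated
  -- with, and so independent of, the `w` direction.
  set α := inner ℝ v m / a
  set u := v - α • w with hu
  have hum : inner ℝ u m = 0 := by
    rw [hu, inner_sub_left, real_inner_smul_left, ← ha, div_mul_cancel₀ _ hpos.ne', sub_self]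
  have hcov : cov[fun z => inner ℝ w z, fun z => inner ℝ u z; ν] = 0 := by
    rw [← covarianceBilin_apply_eq_cov IsGaussian.memLp_two_id, hw, hum, mul_zero]
  have hind : IndepFun (fun z : V => inner ℝ w z) (fun z => inner ℝ u z) ν := by
    refine HasGaussianLaw.indepFun_of_covariance_eq_zero ?_ hcov
    exact IsGaussian.hasGaussianLaw_id.map ((innerSL ℝ w).prod (innerSL ℝ u))
  have hmeas : Measurable fun x : ℝ => (1 + Real.exp x)⁻¹ := by fun_prop
  have hzero : ∫ z, (1 + Real.exp (inner ℝ w z))⁻¹ * inner ℝ u z ∂ν = 0 := by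
    have h := hind.integral_fun_comp_mul_comp (f := fun x : ℝ => (1 + Real.exp x)⁻¹)
      (g := fun x : ℝ => x) (by fun_prop) (by fun_prop) hmeas.aestronglyMeasurable
      measurable_id.aestronglyMeasurable
    rw [h, integral_inner_gaussian, hum, mul_zero]
  have hline : ∫ z, (1 + Real.exp (inner ℝ w z))⁻¹ * inner ℝ w z ∂ν = 0 := by
    have h : ∫ x, (1 + Real.exp x)⁻¹ * x ∂(ν.map fun z => inner ℝ w z) = 0 := by
      rw [map_inner_eq_gaussianReal, hw]
      exact integral_inv_one_add_exp_mul_gaussianReal hpos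
    rwa [integral_map (by fun_prop) (by fun_prop)] at h
  have hbound : ∀ u' : V, Integrable
      (fun z => (1 + Real.exp (inner ℝ w z))⁻¹ * inner ℝ u' z) ν := fun u' => by
    refine (integrable_inner_gaussian u').bdd_mul (c := 1) (by fun_prop) (ae_of_all _ fun z => ?_)
    have := inv_one_add_exp_mem_Icc (inner ℝ w z)
    rw [Real.norm_of_nonneg this.1]
    exact this.2
  have hsplit : ∀ z, (1 + Real.exp (inner ℝ w z))⁻¹ * inner ℝ v z =
      (1 + Real.exp (inner ℝ w z))⁻¹ * inner ℝ u z +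
        α * ((1 + Real.exp (inner ℝ w z))⁻¹ * inner ℝ w z) := fun z => by
    rw [hu, inner_sub_left, real_inner_smul_left]
    ring
  simp only [hsplit]
  rw [integral_add (hbound u) ((hbound w).const_mul α), integral_const_mul, hzero, hline]
  simp

lemma integrable_exp_mul_inner_sub (v : V) (t : ℝ) :
    Integrable (fun z => Real.exp (t * (inner ℝ v z - inner ℝ v (∫ z, z ∂ν)))) ν := by
  have h := integrable_exp_mul_gaussianReal (μ := inner ℝ v (∫ z, z ∂ν))
    (v := (covarianceBilin ν v v).toNNReal) t
  rw [← map_inner_eq_gaussianReal] at h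
  have h' : Integrable (fun z => Real.exp (t * inner ℝ v z)) ν :=
    (integrable_map_measure (f := fun z : V => inner ℝ v z) (g := fun x : ℝ => Real.exp (t * x))
      (by fun_prop) (by fun_prop)).1 h
  simp_rw [mul_sub, sub_eq_add_neg, Real.exp_add]
  exact h'.mul_const _

lemma integral_exp_mul_inner_sub (v : V) (t : ℝ) :
    ∫ z, Real.exp (t * (inner ℝ v z - inner ℝ v (∫ z, z ∂ν))) ∂ν =
      Real.exp (covarianceBilin ν v v * t ^ 2 / 2) := by
  have h := mgf_gaussianReal (map_inner_eq_gaussianReal (ν := ν) v) t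
  rw [Real.coe_toNNReal _ (covarianceBilin_self_nonneg v), mgf] at h
  simp_rw [mul_sub, sub_eq_add_neg, Real.exp_add]
  rw [integral_mul_const, h, ← Real.exp_add]
  congr 1
  ring

lemma integrable_exp_mul_abs_inner_sub (v : V) (t : ℝ) :
    Integrable (fun z => Real.exp (t * |inner ℝ v z - inner ℝ v (∫ z, z ∂ν)|)) ν := by
  refine ((integrable_exp_mul_inner_sub (ν := ν) v t).add
    (integrable_exp_mul_inner_sub v (-t))).mono' (by fun_prop) (ae_of_all _ fun z => ?_)
  rw [Real.norm_of_nonneg (Real.exp_pos _).le]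
  exact exp_mul_abs_le _ _

lemma integral_exp_mul_abs_inner_sub_le (v : V) (t : ℝ) :
    ∫ z, Real.exp (t * |inner ℝ v z - inner ℝ v (∫ z, z ∂ν)|) ∂ν ≤
      2 * Real.exp (covarianceBilin ν v v * t ^ 2 / 2) := by
  have h := integral_mono (integrable_exp_mul_abs_inner_sub (ν := ν) v t)
    ((integrable_exp_mul_inner_sub v t).add (integrable_exp_mul_inner_sub v (-t)))
    fun z => exp_mul_abs_le t (inner ℝ v z - inner ℝ v (∫ z, z ∂ν))
  simp only [Pi.add_apply] at h
  rw [integral_add (integrable_exp_mul_inner_sub v t) (integrable_exp_mul_inner_sub v (-t)),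
    integral_exp_mul_inner_sub, integral_exp_mul_inner_sub, neg_sq] at h
  linarith

lemma integrable_exp_mul_abs_inner (v : V) {t : ℝ} (ht : 0 ≤ t) :
    Integrable (fun z => Real.exp (t * |inner ℝ v z|)) ν := by
  refine ((integrable_exp_mul_abs_inner_sub (ν := ν) v t).const_mul
    (Real.exp (t * |inner ℝ v (∫ z, z ∂ν)|))).mono' (by fun_prop) (ae_of_all _ fun z => ?_)
  rw [Real.norm_of_nonneg (Real.exp_pos _).le]
  exact exp_mul_abs_inner_le v z _ ht

lemma integral_exp_mul_abs_inner_le (v : V) {t : ℝ} (ht : 0 ≤ t) :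
    ∫ z, Real.exp (t * |inner ℝ v z|) ∂ν ≤
      2 * Real.exp (t * |inner ℝ v (∫ z, z ∂ν)| + covarianceBilin ν v v * t ^ 2 / 2) := by
  have h := integral_mono (integrable_exp_mul_abs_inner (ν := ν) v ht)
    ((integrable_exp_mul_abs_inner_sub (ν := ν) v t).const_mul
      (Real.exp (t * |inner ℝ v (∫ z, z ∂ν)|)))
    fun z => exp_mul_abs_inner_le v z _ ht
  rw [integral_const_mul] at h
  refine h.trans ((mul_le_mul_of_nonneg_left (integral_exp_mul_abs_inner_sub_le v t)
    (Real.exp_pos _).le).trans (le_of_eq ?_))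
  rw [Real.exp_add]
  ring

lemma integrable_inner_sub_pow_four (v : V) :
    Integrable (fun z => (inner ℝ v z - inner ℝ v (∫ z, z ∂ν)) ^ 4) ν := by
  refine ((integrable_exp_mul_abs_inner_sub (ν := ν) v 1).const_mul 24).mono' (by fun_prop)
    (ae_of_all _ fun z => ?_)
  rw [Real.norm_of_nonneg (by positivity)]
  simpa using pow_four_le_exp_mul_abs one_pos (inner ℝ v z - inner ℝ v (∫ z, z ∂ν))

/-- The parameter `t` is kept free for scaling: for variance of order `κ⁻¹`, the choice `t = √κ`
yields the right order `κ⁻²`. -/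
lemma integral_inner_sub_pow_four_le (v : V) {t : ℝ} (ht : 0 < t) :
    ∫ z, (inner ℝ v z - inner ℝ v (∫ z, z ∂ν)) ^ 4 ∂ν ≤
      48 / t ^ 4 * Real.exp (covarianceBilin ν v v * t ^ 2 / 2) := by
  have h := integral_mono (integrable_inner_sub_pow_four (ν := ν) v)
    ((integrable_exp_mul_abs_inner_sub (ν := ν) v t).const_mul (24 / t ^ 4))
    fun z => pow_four_le_exp_mul_abs ht _
  rw [integral_const_mul] at h
  refine h.trans ((mul_le_mul_of_nonneg_left (integral_exp_mul_abs_inner_sub_le v t)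
    (by positivity)).trans (le_of_eq ?_))
  ring

/-- The second moments of a Gaussian measure are carried, up to a small error, by a large ball. -/
lemma covarianceBilin_sub_le_integral_indicator {ι : Type*} [Fintype ι]
    (b : OrthonormalBasis ι ℝ V) {R t B : ℝ} (hR : 0 < R) (hm : 2 * ‖∫ z, z ∂ν‖ ≤ R)
    (ht : 0 < t) (hB : ∀ i, covarianceBilin ν (b i) (b i) * t ^ 2 ≤ B) (v : V) :
    covarianceBilin ν v v -
        768 * (Fintype.card ι : ℝ) ^ 2 * Real.exp (B / 2) / (R ^ 2 * t ^ 4) * ‖v‖ ^ 2 ≤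
      ∫ z, (Metric.closedBall 0 R).indicator (fun z => (inner ℝ v z) ^ 2) z ∂ν := by
  set m := ∫ z, z ∂ν with hmdef
  have hsq : Integrable (fun z => (inner ℝ v z) ^ 2) ν := by
    simpa only [sq] using integrable_inner_mul_inner v v
  have hind : Integrable ((Metric.closedBall 0 R).indicator fun z => (inner ℝ v z) ^ 2) ν :=
    hsq.indicator measurableSet_closedBall
  have hfour : Integrable (fun z => ∑ i, (inner ℝ (b i) z - inner ℝ (b i) m) ^ 4) ν :=
    integrable_finsetSum _ fun i _ => integrable_inner_sub_pow_four (b i)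
  have h1 := integral_mono hsq (hind.add (hfour.const_mul _))
    fun z => sq_inner_le_indicator_add b hR hm v z
  simp only [Pi.add_apply] at h1
  rw [integral_add hind (hfour.const_mul _), integral_const_mul,
    integral_finsetSum _ fun i _ => integrable_inner_sub_pow_four (b i)] at h1
  have h2 : covarianceBilin ν v v ≤ ∫ z, (inner ℝ v z) ^ 2 ∂ν := by
    rw [covarianceBilin_self IsGaussian.memLp_two_id]
    exact variance_le_expectation_sq (by fun_prop)
  have h3 : ∑ i, ∫ z, (inner ℝ (b i) z - inner ℝ (b i) m) ^ 4 ∂ν ≤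
      Fintype.card ι * (48 / t ^ 4 * Real.exp (B / 2)) := by
    have : ∀ i ∈ Finset.univ, ∫ z, (inner ℝ (b i) z - inner ℝ (b i) m) ^ 4 ∂ν ≤
        48 / t ^ 4 * Real.exp (B / 2) := fun i _ =>
      (integral_inner_sub_pow_four_le (b i) ht).trans (by gcongr; exact hB i)
    refine (Finset.sum_le_sum this).trans (le_of_eq ?_)
    rw [Finset.sum_const, Finset.card_univ, nsmul_eq_mul]
  have h4 := mul_le_mul_of_nonneg_left h3
    (show 0 ≤ ‖v‖ ^ 2 * (16 * Fintype.card ι / R ^ 2) by positivity)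
  have h5 : ‖v‖ ^ 2 * (16 * Fintype.card ι / R ^ 2) *
      (Fintype.card ι * (48 / t ^ 4 * Real.exp (B / 2))) =
      768 * (Fintype.card ι : ℝ) ^ 2 * Real.exp (B / 2) / (R ^ 2 * t ^ 4) * ‖v‖ ^ 2 := by
    field_simp
    ring
  linarith

end Gaussian

/-! ### The law of signed examples and the deterministic part of the argument. -/

section SignedPoint

variable {d n : ℕ}

lemma measurable_signedPoint : Measurable (signedPoint (d := d)) := by
  have : Measurable labelValue := measurable_of_finite _
  unfold signedPoint
  fun_prop

lemma multivariateGaussian_neg_map_neg {m : EuclideanSpace ℝ (Fin d)}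
    {S : Matrix (Fin d) (Fin d) ℝ} (hS : S.PosSemidef) :
    (multivariateGaussian (-m) S).map (fun x => (-1 : ℝ) • x) = multivariateGaussian m S := by
  have : IsProbabilityMeasure ((multivariateGaussian (-m) S).map fun x => (-1 : ℝ) • x) :=
    Measure.isProbabilityMeasure_map (by fun_prop)
  refine Measure.ext_of_charFun ?_
  ext x
  rw [charFun_map_smul, charFun_multivariateGaussian hS, charFun_multivariateGaussian hS]
  simp [Matrix.mulVec_neg]

/-- The reflection sends `N(-μ, κ⁻¹Σ)` to `N(μ, κ⁻¹Σ)`, so the two halves of the mixture coincide.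
-/
lemma map_signedPoint_dataDist (μ : EuclideanSpace ℝ (Fin d)) {Cov : Matrix (Fin d) (Fin d) ℝ}
    {κ : ℝ} (hS : (κ⁻¹ • Cov).PosSemidef) :
    (dataDist μ Cov κ).map signedPoint = multivariateGaussian μ (κ⁻¹ • Cov) := by
  have h1 : (signedPoint ∘ fun x : EuclideanSpace ℝ (Fin d) => (x, (1 : Fin 2))) = id := by
    ext x; norm_num [signedPoint, labelValue]
  have h0 : (signedPoint ∘ fun x : EuclideanSpace ℝ (Fin d) => (x, (0 : Fin 2))) =
      fun x => (-1 : ℝ) • x := by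
    ext x; simp [signedPoint, labelValue]
  rw [dataDist, Measure.map_add _ _ measurable_signedPoint, Measure.map_smul, Measure.map_smul,
    Measure.prod_dirac, Measure.prod_dirac, Measure.map_map measurable_signedPoint (by fun_prop),
    Measure.map_map measurable_signedPoint (by fun_prop), h1, h0, Measure.map_id,
    multivariateGaussian_neg_map_neg hS, ← add_smul, ENNReal.inv_two_add_inv_two, one_smul]

lemma indicator_sq_inner_eq_sum {R : ℝ} (v z : EuclideanSpace ℝ (Fin d)) :
    (Metric.closedBall 0 R).indicator (fun z => (inner ℝ v z) ^ 2) z = ∑ j, ∑ k, v j * v k *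
      (Metric.closedBall 0 R).indicator (fun z : EuclideanSpace ℝ (Fin d) => z j * z k) z := by
  by_cases hz : z ∈ Metric.closedBall 0 R
  · simp only [indicator_of_mem hz, sq, PiLp.inner_apply, Finset.sum_mul_sum]
    refine Finset.sum_congr rfl fun j _ => Finset.sum_congr rfl fun k _ => ?_
    simp
    ring
  · simp [indicator_of_notMem hz]

/-- A training set whose empirical gradient at `w₀` is small and whose truncated empirical second
moments are close to a positive definite matrix has a unique empirical risk minimizer near `w₀`. -/
lemma exists_isUniqueMinimizer_empiricalLoss {S : Fin n → Example d}
    {w₀ : EuclideanSpace ℝ (Fin d)} {R s γ ε : ℝ} {M : Fin d → Fin d → ℝ} (hn : 0 < n)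
    (hw₀ : w₀ ≠ 0) (hγ : 0 < γ) (hε : 0 < ε) (hε1 : ε ≤ 1) (hs : d * s ≤ γ)
    (hs' : d * s < Real.exp (-(2 * ‖w₀‖ * R)) / 8 * γ * (ε * ‖w₀‖))
    (hgrad : ∀ j, |∑ i, -(1 + Real.exp (inner ℝ w₀ (signedPoint (S i))))⁻¹ * signedPoint (S i) j|
      < n * s)
    (hM : ∀ v : EuclideanSpace ℝ (Fin d), 2 * γ * ‖v‖ ^ 2 ≤ ∑ j, ∑ k, v j * v k * M j k)
    (hmat : ∀ j k, |∑ i, ((Metric.closedBall 0 R).indicator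
      (fun z : EuclideanSpace ℝ (Fin d) => z j * z k) (signedPoint (S i)) - M j k)| < n * s) :
    ∃ w, IsUniqueMinimizer (empiricalLoss S) w ∧ ‖w - w₀‖ ≤ ε * ‖w₀‖ := by
  have hn' : (0 : ℝ) < n := by exact_mod_cast hn
  have hw₀' : 0 < ‖w₀‖ := norm_pos_iff.2 hw₀
  have hG : ‖empiricalGradient S w₀‖ ≤ d * s := by
    have hcoord : ∀ j, |empiricalGradient S w₀ j| ≤ s := fun j => by
      have h : empiricalGradient S w₀ j = (1 / (n : ℝ)) *
          ∑ i, -(1 + Real.exp (inner ℝ w₀ (signedPoint (S i))))⁻¹ * signedPoint (S i) j := by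
        simp [empiricalGradient]
      rw [h, abs_mul, abs_of_pos (by positivity), one_div_mul_eq_div, div_le_iff₀ hn', mul_comm s]
      exact (hgrad j).le
    calc ‖empiricalGradient S w₀‖
        = ‖∑ j, empiricalGradient S w₀ j • EuclideanSpace.basisFun (Fin d) ℝ j‖ := by
          conv_lhs => rw [← (EuclideanSpace.basisFun (Fin d) ℝ).sum_repr (empiricalGradient S w₀)]
          simp
      _ ≤ ∑ j : Fin d, s := by
          refine norm_sum_le_of_le _ fun j _ => ?_
          rw [norm_smul, OrthonormalBasis.norm_eq_one, mul_one]
          exact hcoord j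
      _ = d * s := by simp
  have hquad : ∀ v : EuclideanSpace ℝ (Fin d), γ * ‖v‖ ^ 2 ≤ (1 / (n : ℝ)) *
      ∑ i, (Metric.closedBall 0 R).indicator (fun z => (inner ℝ v z) ^ 2) (signedPoint (S i)) := by
    intro v
    set T : Fin d → Fin d → ℝ := fun j k => ∑ i, ((Metric.closedBall 0 R).indicator
      (fun z : EuclideanSpace ℝ (Fin d) => z j * z k) (signedPoint (S i)) - M j k) with hT
    have hsum : ∑ i, (Metric.closedBall 0 R).indicator (fun z => (inner ℝ v z) ^ 2)
        (signedPoint (S i)) = n * (∑ j, ∑ k, v j * v k * M j k) +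
          ∑ j, ∑ k, v j * v k * T j k := by
      simp only [indicator_sq_inner_eq_sum, hT]
      rw [Finset.sum_comm, Finset.mul_sum, ← Finset.sum_add_distrib]
      refine Finset.sum_congr rfl fun j _ => ?_
      rw [Finset.sum_comm, Finset.mul_sum, ← Finset.sum_add_distrib]
      refine Finset.sum_congr rfl fun k _ => ?_
      rw [← Finset.mul_sum, Finset.sum_sub_distrib, Finset.sum_const, Finset.card_univ,
        Fintype.card_fin, nsmul_eq_mul]
      ring
    have hcs : (∑ j, |v j|) ^ 2 ≤ d * ‖v‖ ^ 2 := by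
      have := sq_sum_le_card_mul_sum_sq (s := Finset.univ) (f := fun j => |v j|)
      rw [EuclideanSpace.real_norm_sq_eq]
      simpa using this
    -- Entrywise errors cost at most `s (∑ |v j|)² ≤ d s ‖v‖²`, half of the curvature `2γ` in `hM`.
    have herr : |∑ j, ∑ k, v j * v k * T j k| ≤ n * (γ * ‖v‖ ^ 2) := by
      calc |∑ j, ∑ k, v j * v k * T j k| ≤ ∑ j, ∑ k, |v j| * |v k| * (n * s) := by
            refine (Finset.abs_sum_le_sum_abs _ _).trans (Finset.sum_le_sum fun j _ => ?_)
            refine (Finset.abs_sum_le_sum_abs _ _).trans (Finset.sum_le_sum fun k _ => ?_)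
            rw [abs_mul, abs_mul]
            gcongr
            exact (hmat j k).le
        _ = n * (s * (∑ j, |v j|) ^ 2) := by
            rw [sq, Finset.sum_mul_sum]
            simp only [Finset.mul_sum]
            refine Finset.sum_congr rfl fun j _ => Finset.sum_congr rfl fun k _ => ?_
            ring
        _ ≤ n * (γ * ‖v‖ ^ 2) := by
            -- The sign of `s` is forced by `hgrad` as soon as a coordinate exists.
            have hs0 : 0 ≤ s ∨ d = 0 := by
              by_contra! h
              obtain ⟨j⟩ : Nonempty (Fin d) := ⟨⟨0, Nat.pos_of_ne_zero h.2⟩⟩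
              have := (abs_nonneg _).trans_lt (hgrad j)
              nlinarith
            refine mul_le_mul_of_nonneg_left ?_ hn'.le
            rcases hs0 with hs0 | rfl
            · calc s * (∑ j, |v j|) ^ 2 ≤ s * (d * ‖v‖ ^ 2) := by gcongr
                _ = d * s * ‖v‖ ^ 2 := by ring
                _ ≤ _ := by gcongr
            · simpa using by positivity
    rw [one_div_mul_eq_div, le_div_iff₀ hn', hsum]
    have := neg_le_of_abs_le herr
    nlinarith [mul_le_mul_of_nonneg_left (hM v) hn'.le]
  -- As `ε ≤ 1`, the ball of radius `2‖w₀‖` about `0` contains the ball of radius `ε‖w₀‖` about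
  -- `w₀`.
  refine exists_isUniqueMinimizer_norm_sub_le (G := empiricalGradient S) (W := 2 * ‖w₀‖)
    (β := Real.exp (-(2 * ‖w₀‖ * R)) / 8 * γ)
    (continuous_empiricalLoss S) (convexOn_empiricalLoss S) (by positivity) (by positivity)
    (fun u v hu hv => ?_) ?_ (hG.trans_lt hs')
  · refine le_trans ?_ (empiricalLoss_tangent_add_sq_le S (R := R) hu hv)
    rw [mul_assoc]
    exact add_le_add_right (mul_le_mul_of_nonneg_left (hquad _) (by positivity)) _
  · nlinarith

end SignedPoint

/-! ### Concentration of the gradient and the truncated moments. -/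

variable {d : ℕ}

/-- The matrix of second moments of `ν` restricted to the closed ball of radius `R`. -/
noncomputable def truncatedMoment (ν : Measure (EuclideanSpace ℝ (Fin d))) (R : ℝ)
    (j k : Fin d) : ℝ :=
  ∫ z, (Metric.closedBall 0 R).indicator (fun z : EuclideanSpace ℝ (Fin d) => z j * z k) z ∂ν

lemma abs_indicator_mul_le {R : ℝ} (j k : Fin d) (z : EuclideanSpace ℝ (Fin d)) :
    |(Metric.closedBall 0 R).indicator (fun z : EuclideanSpace ℝ (Fin d) => z j * z k) z|
      ≤ R ^ 2 := by
  by_cases hz : z ∈ Metric.closedBall 0 R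
  · rw [indicator_of_mem hz, abs_mul, sq]
    rw [mem_closedBall_zero_iff] at hz
    have hj : |z j| ≤ R := (PiLp.norm_apply_le z j).trans hz
    have hk : |z k| ≤ R := (PiLp.norm_apply_le z k).trans hz
    exact mul_le_mul hj hk (abs_nonneg _) ((abs_nonneg _).trans hj)
  · rw [indicator_of_notMem hz, abs_zero]
    positivity

lemma measurable_indicator_mul {R : ℝ} (j k : Fin d) : Measurable
    ((Metric.closedBall 0 R).indicator fun z : EuclideanSpace ℝ (Fin d) => z j * z k) :=
  Measurable.indicator (by fun_prop) measurableSet_closedBall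

lemma integrable_indicator_mul {ν : Measure (EuclideanSpace ℝ (Fin d))} [IsProbabilityMeasure ν]
    {R : ℝ} (j k : Fin d) : Integrable
    ((Metric.closedBall 0 R).indicator fun z : EuclideanSpace ℝ (Fin d) => z j * z k) ν :=
  Integrable.of_bound (measurable_indicator_mul j k).aestronglyMeasurable (R ^ 2)
    (ae_of_all _ fun z => abs_indicator_mul_le j k z)

lemma integral_indicator_sq_inner {ν : Measure (EuclideanSpace ℝ (Fin d))}
    [IsProbabilityMeasure ν] {R : ℝ} (v : EuclideanSpace ℝ (Fin d)) :
    ∫ z, (Metric.closedBall 0 R).indicator (fun z => (inner ℝ v z) ^ 2) z ∂ν =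
      ∑ j, ∑ k, v j * v k * truncatedMoment ν R j k := by
  simp only [indicator_sq_inner_eq_sum]
  rw [integral_finsetSum _ fun j _ => integrable_finsetSum _ fun k _ =>
    (integrable_indicator_mul j k).const_mul _]
  refine Finset.sum_congr rfl fun j _ => ?_
  rw [integral_finsetSum _ fun k _ => (integrable_indicator_mul j k).const_mul _]
  refine Finset.sum_congr rfl fun k _ => ?_
  rw [integral_const_mul, truncatedMoment]

/-- With high probability, the empirical gradient and the truncated empirical second moments of a
training set are close to their expectations. -/
lemma exists_event_forall_abs_sum_lt {μ : EuclideanSpace ℝ (Fin d)}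
    {Cov : Matrix (Fin d) (Fin d) ℝ} {κ : ℝ} (hS : (κ⁻¹ • Cov).PosSemidef)
    {w₀ : EuclideanSpace ℝ (Fin d)} {R C s : ℝ}
    (hzero : ∀ j, ∫ z, (1 + Real.exp (inner ℝ w₀ z))⁻¹ * z j
      ∂(multivariateGaussian μ (κ⁻¹ • Cov)) = 0)
    (hint : ∀ j, Integrable (fun z : EuclideanSpace ℝ (Fin d) => Real.exp (2 * |z j|))
      (multivariateGaussian μ (κ⁻¹ • Cov)))
    (hC : ∀ j, ∫ z, Real.exp (2 * |z j|) ∂(multivariateGaussian μ (κ⁻¹ • Cov)) ≤ C)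
    (hRC : Real.exp (4 * R ^ 2) ≤ C) (hs : 0 ≤ s) (hsC : s ≤ 4 * C) (n : ℕ) :
    ∃ A : Set (Fin n → Example d), MeasurableSet A ∧
      ENNReal.ofReal (1 - 2 * (d + d ^ 2) * Real.exp (-(n * s ^ 2 / (8 * C)))) ≤
        trainingDist μ Cov κ n A ∧
      ∀ S ∈ A, (∀ j, |∑ i, -(1 + Real.exp (inner ℝ w₀ (signedPoint (S i))))⁻¹ *
          signedPoint (S i) j| < n * s) ∧
        ∀ j k, |∑ i, ((Metric.closedBall 0 R).indicator
          (fun z : EuclideanSpace ℝ (Fin d) => z j * z k) (signedPoint (S i)) -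
            truncatedMoment (multivariateGaussian μ (κ⁻¹ • Cov)) R j k)| < n * s := by
  set ν := multivariateGaussian μ (κ⁻¹ • Cov) with hν
  have hmap : (dataDist μ Cov κ).map signedPoint = ν := map_signedPoint_dataDist μ hS
  -- One family for all `d + d²` centred statistics, so that a single union bound suffices.
  let g : Fin d ⊕ (Fin d × Fin d) → EuclideanSpace ℝ (Fin d) → ℝ :=
    Sum.elim (fun j z => -(1 + Real.exp (inner ℝ w₀ z))⁻¹ * z j)
      (fun jk z => (Metric.closedBall 0 R).indicator
        (fun z : EuclideanSpace ℝ (Fin d) => z jk.1 * z jk.2) z - truncatedMoment ν R jk.1 jk.2)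
  have hg : ∀ k, Measurable (g k) := by
    rintro (j | ⟨j, k⟩)
    · simp only [g, Sum.elim_inl]; fun_prop
    · exact (measurable_indicator_mul j k).sub_const _
  have hgint : ∀ k, Integrable (fun z => Real.exp (2 * |g k z|)) ν ∧
      ∫ z, Real.exp (2 * |g k z|) ∂ν ≤ C := by
    rintro (j | ⟨j, k⟩)
    · have hle : ∀ z, Real.exp (2 * |g (.inl j) z|) ≤ Real.exp (2 * |z j|) := fun z => by
        have := inv_one_add_exp_mem_Icc (inner ℝ w₀ z)
        simp only [g, Sum.elim_inl]
        rw [abs_mul, abs_neg, abs_of_nonneg this.1]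
        gcongr
        exact mul_le_of_le_one_left (abs_nonneg _) this.2
      have hi : Integrable (fun z => Real.exp (2 * |g (.inl j) z|)) ν := by
        refine (hint j).mono' ?_ (ae_of_all _ fun z => ?_)
        · have := hg (.inl j)
          fun_prop
        · rw [Real.norm_of_nonneg (Real.exp_pos _).le]
          exact hle z
      exact ⟨hi, (integral_mono hi (hint j) hle).trans (hC j)⟩
    -- A truncated product and its mean are each at most `R²` in absolute value, whence `2 * (2R²)`.
    · have hle : ∀ z, Real.exp (2 * |g (.inr (j, k)) z|) ≤ Real.exp (4 * R ^ 2) := fun z => by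
        have h1 := abs_indicator_mul_le (R := R) j k z
        have h2 : |truncatedMoment ν R j k| ≤ R ^ 2 := by
          simpa [truncatedMoment] using norm_integral_le_of_norm_le_const (μ := ν)
            (f := (Metric.closedBall 0 R).indicator fun z : EuclideanSpace ℝ (Fin d) => z j * z k)
            (ae_of_all _ (abs_indicator_mul_le j k))
        have h3 := abs_sub ((Metric.closedBall 0 R).indicator
          (fun z : EuclideanSpace ℝ (Fin d) => z j * z k) z) (truncatedMoment ν R j k)
        refine Real.exp_le_exp.2 ?_
        simp only [g, Sum.elim_inr]
        linarith
      have hi : Integrable (fun z => Real.exp (2 * |g (.inr (j, k)) z|)) ν := by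
        refine Integrable.of_bound ?_ (Real.exp (4 * R ^ 2)) (ae_of_all _ fun z => ?_)
        · have := hg (.inr (j, k))
          fun_prop
        · rw [Real.norm_of_nonneg (Real.exp_pos _).le]
          exact hle z
      refine ⟨hi, (integral_mono hi (integrable_const _) hle).trans ?_⟩
      simpa using hRC
  have hg0 : ∀ k, ∫ z, g k z ∂ν = 0 := by
    rintro (j | ⟨j, k⟩)
    · simp only [g, Sum.elim_inl, neg_mul, integral_neg, hzero j, neg_zero]
    · simp only [g, Sum.elim_inr]
      rw [integral_sub (integrable_indicator_mul j k) (integrable_const _), integral_const]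
      simp [truncatedMoment]
  have hexp : ∀ k, AEStronglyMeasurable (fun z => Real.exp (2 * |g k z|))
      ((dataDist μ Cov κ).map signedPoint) := fun k => by
    have := hg k
    fun_prop
  have hmeas := (measurable_signedPoint (d := d)).aemeasurable (μ := dataDist μ Cov κ)
  have key := one_sub_le_pi_forall_abs_sum_lt (P := dataDist μ Cov κ)
    (X := fun k p => g k (signedPoint p)) (C := C) (s := s)
    (fun k => (hg k).comp measurable_signedPoint)
    (fun k => (integrable_map_measure (hexp k) hmeas).1 (by rw [hmap]; exact (hgint k).1))
    (fun k => by rw [← integral_map hmeas (hexp k), hmap]; exact (hgint k).2)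
    (fun k => by
      rw [← integral_map hmeas (hg k).aestronglyMeasurable, hmap]; exact hg0 k)
    ((Real.exp_pos _).trans_le hRC) hs hsC n
  refine ⟨_, key.1, ?_, fun S hS => ⟨fun j => hS (.inl j), fun j k => hS (.inr (j, k))⟩⟩
  refine le_trans (le_of_eq ?_) key.2
  simp only [Fintype.card_sum, Fintype.card_prod, Fintype.card_fin]
  push_cast
  rw [sq (d : ℝ)]

/-! ### Choice of constants and conclusion. -/

lemma exists_pos_forall_le_dotProduct_mulVec {Cov : Matrix (Fin d) (Fin d) ℝ}
    (hCov : Cov.PosDef) : ∃ l : ℝ, 0 < l ∧ ∀ v : EuclideanSpace ℝ (Fin d),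
      l * ‖v‖ ^ 2 ≤ v.ofLp ⬝ᵥ Cov.mulVec v.ofLp := by
  have hcont : Continuous fun v : EuclideanSpace ℝ (Fin d) => v.ofLp ⬝ᵥ Cov.mulVec v.ofLp := by
    fun_prop
  have hpos : ∀ v : EuclideanSpace ℝ (Fin d), v ≠ 0 → 0 < v.ofLp ⬝ᵥ Cov.mulVec v.ofLp :=
    fun v hv => by
      have := hCov.dotProduct_mulVec_pos (x := v.ofLp) (by simpa using hv)
      simpa using this
  -- The minimum over the unit sphere serves as `l`; an empty sphere leaves only the zero vector.
  rcases (Metric.sphere (0 : EuclideanSpace ℝ (Fin d)) 1).eq_empty_or_nonempty with h | h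
  · refine ⟨1, one_pos, fun v => ?_⟩
    have hv : v = 0 := by
      by_contra hv
      have : (‖v‖⁻¹ • v) ∈ Metric.sphere (0 : EuclideanSpace ℝ (Fin d)) 1 := by
        simp [norm_smul, hv]
      simp [h] at this
    simp [hv]
  · obtain ⟨x, hx, hmin⟩ := (isCompact_sphere _ _).exists_isMinOn h hcont.continuousOn
    refine ⟨_, hpos x ?_, fun v => ?_⟩
    · rintro rfl
      simp at hx
    · by_cases hv : v = 0
      · simp [hv]
      have hnv : ‖v‖ ≠ 0 := norm_ne_zero_iff.2 hv
      have := hmin (show (‖v‖⁻¹ • v) ∈ Metric.sphere (0 : EuclideanSpace ℝ (Fin d)) 1 by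
        simp [norm_smul, hv])
      simp only [mem_ofPred_eq, WithLp.ofLp_smul, Matrix.mulVec_smul, smul_dotProduct,
        dotProduct_smul, smul_eq_mul] at this
      rw [← mul_assoc, ← mul_inv, ← sq, inv_mul_eq_div, le_div_iff₀ (by positivity)] at this
      exact this

/-- An exponential in `κ ^ 2` dominates the sample size needed at concentration level
`exp (-b κ) ε`. -/
lemma card_mul_exp_neg_le {b a C N c : ℝ} (hb : 0 ≤ b) (ha : 0 < a) (hC : 0 < C) (hN : 1 ≤ N)
    (hc : 0 < c) {κ ε δ n : ℝ}
    (hκ : 1 + (2 * b + |Real.log (8 * C * (1 + Real.log N) / a ^ 2)|) / c ≤ κ)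
    (hε : ε ∈ Ioo (0 : ℝ) 1) (hδ : δ ∈ Ioo (0 : ℝ) 1)
    (hn : Real.exp (c * κ ^ 2) / ε ^ 4 * (1 + Real.log (1 / ε) + Real.log (1 / δ)) ≤ n) :
    N * Real.exp (-(n * (a * Real.exp (-b * κ) * ε) ^ 2 / (8 * C))) ≤ δ := by
  obtain ⟨hε0, hε1⟩ := hε
  obtain ⟨hδ0, hδ1⟩ := hδ
  have hlogN : 0 ≤ Real.log N := Real.log_nonneg hN
  have hlogε : 0 ≤ Real.log (1 / ε) := Real.log_nonneg (one_le_one_div hε0 hε1.le)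
  have hlogδ : 0 ≤ Real.log (1 / δ) := Real.log_nonneg (one_le_one_div hδ0 hδ1.le)
  set K := 8 * C * (1 + Real.log N) / a ^ 2 with hK
  have hKpos : 0 < K := by positivity
  have hdiv : 0 ≤ (2 * b + |Real.log K|) / c := by positivity
  have hκ1 : 1 ≤ κ := by linarith
  have hcκ : 2 * b + |Real.log K| ≤ c * κ := by
    have : (2 * b + |Real.log K|) / c ≤ κ := by linarith
    rwa [div_le_iff₀ hc, mul_comm κ] at this
  -- Since `κ ≥ 1`, `cκ² ≥ (2b + |log K|)κ ≥ 2bκ + log K`.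
  have hKexp : K ≤ Real.exp (c * κ ^ 2 - 2 * b * κ) := by
    rw [← Real.log_le_iff_le_exp hKpos]
    have h1 : |Real.log K| * 1 ≤ |Real.log K| * κ := by gcongr
    nlinarith [le_abs_self (Real.log K)]
  have h1 : (1 + Real.log N) * (1 + Real.log (1 / δ)) ≤
      n * (a * Real.exp (-b * κ) * ε) ^ 2 / (8 * C) := by
    calc (1 + Real.log N) * (1 + Real.log (1 / δ))
        = K * (1 + Real.log (1 / δ)) * a ^ 2 / (8 * C) := by
          rw [hK]; field_simp
      _ ≤ Real.exp (c * κ ^ 2 - 2 * b * κ) * (1 + Real.log (1 / δ)) * a ^ 2 / (8 * C) := by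
          gcongr
      -- Only `ε⁻²` is needed to offset the squared accuracy; the remaining `ε⁻²` and `log (1 / ε)`
      -- are slack.
      _ ≤ Real.exp (c * κ ^ 2 - 2 * b * κ) *
            ((1 + Real.log (1 / ε) + Real.log (1 / δ)) / ε ^ 2) * a ^ 2 / (8 * C) := by
          gcongr
          rw [le_div_iff₀ (by positivity)]
          have : ε ^ 2 ≤ 1 := pow_le_one₀ hε0.le hε1.le
          nlinarith
      _ = Real.exp (c * κ ^ 2) / ε ^ 4 * (1 + Real.log (1 / ε) + Real.log (1 / δ)) *
            (a * Real.exp (-b * κ) * ε) ^ 2 / (8 * C) := by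
          rw [mul_pow, mul_pow, ← Real.exp_nat_mul, sub_eq_add_neg, Real.exp_add]
          push_cast
          rw [show 2 * (-b * κ) = -(2 * b * κ) by ring]
          field_simp
      _ ≤ n * (a * Real.exp (-b * κ) * ε) ^ 2 / (8 * C) := by gcongr
  have h2 : Real.log N + Real.log (1 / δ) ≤
      n * (a * Real.exp (-b * κ) * ε) ^ 2 / (8 * C) := by
    nlinarith [mul_nonneg hlogN hlogδ]
  calc N * Real.exp (-(n * (a * Real.exp (-b * κ) * ε) ^ 2 / (8 * C)))
      ≤ N * Real.exp (-(Real.log N + Real.log (1 / δ))) := by gcongr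
    _ = δ := by
        rw [neg_add, Real.exp_add, Real.exp_neg, Real.exp_log (by linarith), one_div,
          Real.log_inv, neg_neg, Real.exp_log hδ0, ← mul_assoc,
          mul_inv_cancel₀ (by linarith), one_mul]

lemma mulVec_toEuclideanCLM_inv {Cov : Matrix (Fin d) (Fin d) ℝ} (hCov : Cov.PosDef)
    (μ : EuclideanSpace ℝ (Fin d)) :
    Cov.mulVec (Matrix.toEuclideanCLM (𝕜 := ℝ) Cov⁻¹ μ).ofLp = μ.ofLp := by
  rw [Matrix.ofLp_toEuclideanCLM, Matrix.mulVec_mulVec,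
    Matrix.mul_nonsing_inv _ ((Matrix.isUnit_iff_isUnit_det _).1 hCov.isUnit), Matrix.one_mulVec]

lemma toEuclideanCLM_inv_ne_zero {Cov : Matrix (Fin d) (Fin d) ℝ} (hCov : Cov.PosDef)
    {μ : EuclideanSpace ℝ (Fin d)} (hμ : μ ≠ 0) :
    Matrix.toEuclideanCLM (𝕜 := ℝ) Cov⁻¹ μ ≠ 0 := fun h0 => hμ (by
  ext j
  simpa [h0] using (congrFun (mulVec_toEuclideanCLM_inv hCov μ) j).symm)

/-- The distance between the Bayes direction and the empirical minimizer is controlled with high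
probability, given explicit constants. -/
lemma exists_event_isUniqueMinimizer {μ : EuclideanSpace ℝ (Fin d)}
    {Cov : Matrix (Fin d) (Fin d) ℝ} (hμ : μ ≠ 0) (hCov : Cov.PosDef) {l D h R κ ε s C : ℝ}
    (hl : 0 < l) (hlCov : ∀ v : EuclideanSpace ℝ (Fin d),
      l * ‖v‖ ^ 2 ≤ v.ofLp ⬝ᵥ Cov.mulVec v.ofLp)
    (hD : ∀ j, Cov j j ≤ D) (hh : h = ‖Matrix.toEuclideanCLM (𝕜 := ℝ) Cov⁻¹ μ‖)
    (hR1 : 1 ≤ R) (hRμ : 2 * ‖μ‖ ≤ R)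
    (hRl : 768 * (d : ℝ) ^ 2 * Real.exp (D / 2) ≤ l / 2 * R) (hκ : 1 ≤ κ)
    (hε : 0 < ε) (hε1 : ε < 1)
    (hC : 2 * Real.exp (2 * ‖μ‖ + 2 * D) ≤ C) (hC' : Real.exp (4 * R ^ 2) ≤ C)
    (hs : 0 ≤ s) (hs1 : s ≤ 1) (hsl : d * s ≤ l / (4 * κ))
    (hsh : d * s < l * h * ε / 16 * Real.exp (-(4 * h * R * κ))) {n : ℕ} (hn : 0 < n) :
    ∃ A : Set (Fin n → Example d), MeasurableSet A ∧
      ENNReal.ofReal (1 - 2 * (d + d ^ 2) * Real.exp (-(n * s ^ 2 / (8 * C)))) ≤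
        trainingDist μ Cov κ n A ∧
      ∀ S ∈ A, ∃ w, IsUniqueMinimizer (empiricalLoss S) w ∧
        1 - ε ≤ cosSim w (Matrix.toEuclideanCLM (𝕜 := ℝ) Cov⁻¹ μ) := by
  have hκ0 : 0 < κ := by linarith
  have hS : (κ⁻¹ • Cov).PosSemidef := (hCov.smul (inv_pos.2 hκ0)).posSemidef
  set ν := multivariateGaussian μ (κ⁻¹ • Cov) with hν
  set u := Matrix.toEuclideanCLM (𝕜 := ℝ) Cov⁻¹ μ with hu
  -- The factor `2κ` makes `κ⁻¹ Σ w₀ = 2μ`, the stationarity condition.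
  set w₀ := (2 * κ) • u with hw₀
  have hmean : ∫ z, z ∂ν = μ := integral_id_multivariateGaussian
  have hcov : ∀ x y, covarianceBilin ν x y = κ⁻¹ * (x.ofLp ⬝ᵥ Cov.mulVec y.ofLp) := fun x y => by
    rw [covarianceBilin_multivariateGaussian hS, Matrix.smul_mulVec, dotProduct_smul, smul_eq_mul]
  have hCovu : Cov.mulVec u.ofLp = μ.ofLp := mulVec_toEuclideanCLM_inv hCov μ
  have hu0 : u ≠ 0 := toEuclideanCLM_inv_ne_zero hCov hμ
  have hw₀0 : w₀ ≠ 0 := smul_ne_zero (by positivity) hu0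
  have hw₀norm : ‖w₀‖ = 2 * κ * h := by
    rw [hw₀, norm_smul, Real.norm_of_nonneg (by positivity), hh]
  have hw₀cov : ∀ v, covarianceBilin ν w₀ v = 2 * inner ℝ v (∫ z, z ∂ν) := fun v => by
    rw [covarianceBilin_comm, hcov, hmean, hw₀, WithLp.ofLp_smul, Matrix.mulVec_smul, hCovu,
      dotProduct_smul, smul_eq_mul, EuclideanSpace.inner_eq_star_dotProduct, star_trivial,
      dotProduct_comm μ.ofLp]
    field_simp
  have hpos : 0 < inner ℝ w₀ (∫ z, z ∂ν) := by
    have h1 := hw₀cov w₀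
    rw [hcov] at h1
    have h2 : 0 < κ⁻¹ * (w₀.ofLp ⬝ᵥ Cov.mulVec w₀.ofLp) := by
      have := norm_pos_iff.2 hw₀0
      have := (show 0 < l * ‖w₀‖ ^ 2 by positivity).trans_le (hlCov w₀)
      positivity
    linarith
  have hb : ∀ j z, inner ℝ (EuclideanSpace.basisFun (Fin d) ℝ j) z = z j := fun j z => by
    simp [EuclideanSpace.inner_single_left]
  have hbcov : ∀ j, covarianceBilin ν (EuclideanSpace.basisFun (Fin d) ℝ j)
      (EuclideanSpace.basisFun (Fin d) ℝ j) = κ⁻¹ * Cov j j := fun j => by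
    rw [hcov]; simp
  have hκinv : κ⁻¹ ≤ 1 := inv_le_one_of_one_le₀ hκ
  have hdiag : ∀ j, κ⁻¹ * Cov j j ≤ D := fun j =>
    (mul_le_of_le_one_left hCov.diag_pos.le hκinv).trans (hD j)
  have hM : ∀ v : EuclideanSpace ℝ (Fin d),
      2 * (l / (4 * κ)) * ‖v‖ ^ 2 ≤ ∑ j, ∑ k, v j * v k * truncatedMoment ν R j k := fun v => by
    -- With `t = √κ` the scaled variances are `Cov j j ≤ D`. The truncation error is then of order
    -- `κ⁻²` and uses at most half of the eigenvalue bound `l / κ`.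
    have h1 := covarianceBilin_sub_le_integral_indicator (ν := ν)
      (EuclideanSpace.basisFun (Fin d) ℝ) (R := R) (t := √κ) (B := D) (by linarith)
      (by rwa [hmean]) (by positivity) (fun j => by
        rw [hbcov, Real.sq_sqrt hκ0.le, mul_right_comm, inv_mul_cancel₀ hκ0.ne', one_mul]
        exact hD j) v
    rw [integral_indicator_sq_inner, hcov, Fintype.card_fin,
      show √κ ^ 4 = κ ^ 2 by rw [show 4 = 2 * 2 from rfl, pow_mul, Real.sq_sqrt hκ0.le]] at h1
    refine le_trans ?_ h1
    have h2 : 768 * (d : ℝ) ^ 2 * Real.exp (D / 2) / (R ^ 2 * κ ^ 2) ≤ l / (2 * κ) := by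
      rw [div_le_div_iff₀ (by positivity) (by positivity)]
      have hRR : l / 2 * R ≤ l / 2 * R ^ 2 := by gcongr; nlinarith
      have hκκ : κ ≤ κ ^ 2 := by nlinarith
      calc 768 * (d : ℝ) ^ 2 * Real.exp (D / 2) * (2 * κ) ≤ l / 2 * R ^ 2 * (2 * κ) :=
            mul_le_mul_of_nonneg_right (hRl.trans hRR) (by positivity)
        _ = l * R ^ 2 * κ := by ring
        _ ≤ l * R ^ 2 * κ ^ 2 := by gcongr
        _ = _ := by ring
    have h3 := mul_le_mul_of_nonneg_right h2 (sq_nonneg ‖v‖)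
    have h4 := mul_le_mul_of_nonneg_left (hlCov v) (inv_pos.2 hκ0).le
    have h5 : κ⁻¹ * (l * ‖v‖ ^ 2) - l / (2 * κ) * ‖v‖ ^ 2 = 2 * (l / (4 * κ)) * ‖v‖ ^ 2 := by
      field_simp
      ring
    linarith
  have hexpint : ∀ j, Integrable (fun z : EuclideanSpace ℝ (Fin d) => Real.exp (2 * |z j|)) ν :=
    fun j => by
      simpa only [hb] using integrable_exp_mul_abs_inner (ν := ν)
        (EuclideanSpace.basisFun (Fin d) ℝ j) zero_le_two
  have hexpC : ∀ j, ∫ z, Real.exp (2 * |z j|) ∂ν ≤ C := fun j => by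
    have h1 := integral_exp_mul_abs_inner_le (ν := ν)
      (EuclideanSpace.basisFun (Fin d) ℝ j) zero_le_two
    simp only [hb, hmean, hbcov] at h1
    refine h1.trans (le_trans ?_ hC)
    have hμj : |μ j| ≤ ‖μ‖ := PiLp.norm_apply_le μ j
    gcongr
    linarith [hdiag j]
  have hzero : ∀ j, ∫ z, (1 + Real.exp (inner ℝ w₀ z))⁻¹ * z j ∂ν = 0 := fun j => by
    simpa only [hb] using integral_inv_one_add_exp_inner_mul_inner hw₀cov hpos
      (EuclideanSpace.basisFun (Fin d) ℝ j)
  have hC1 : s ≤ 4 * C := by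
    have : 1 ≤ Real.exp (4 * R ^ 2) := Real.one_le_exp (by positivity)
    linarith
  obtain ⟨A, hA, hPA, hgood⟩ :=
    exists_event_forall_abs_sum_lt (n := n) hS hzero hexpint hexpC hC' hs hC1
  refine ⟨A, hA, hPA, fun S hSA => ?_⟩
  obtain ⟨hgrad, hmat⟩ := hgood S hSA
  -- With `‖w₀‖ = 2κh`, the `κ` in the radius cancels the one in `γ`, leaving `l h ε / 16` times the
  -- exponential.
  obtain ⟨w, hw, hdist⟩ := exists_isUniqueMinimizer_empiricalLoss (γ := l / (4 * κ)) hn hw₀0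
    (by positivity) hε hε1.le hsl (hsh.trans_eq (by
      rw [hw₀norm, show 2 * (2 * κ * h) * R = 4 * h * R * κ by ring]
      field_simp
      ring)) hgrad hM hmat
  exact ⟨w, hw, one_sub_le_cosSim (by positivity) hu0 hε hε1 hdist⟩

end ERM

theorem theorem2 (d : ℕ) (μ : EuclideanSpace ℝ (Fin d)) (Cov : Matrix (Fin d) (Fin d) ℝ)
    (hμ : μ ≠ 0) (hCov : Cov.PosDef)
    (hnorm : ‖μ‖ ^ 2 = ‖Matrix.toEuclideanCLM (𝕜 := ℝ) Cov‖) :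
    ∀ c : ℝ, 0 < c → ∃ κ₀ : ℝ, 0 < κ₀ ∧ ∀ κ : ℝ, κ₀ ≤ κ →
      ∀ ε δ : ℝ, ε ∈ Set.Ioo (0 : ℝ) 1 → δ ∈ Set.Ioo (0 : ℝ) 1 →
      ∀ n : ℕ,
        Real.exp (c * κ ^ 2) / ε ^ 4 * (1 + Real.log (1 / ε) + Real.log (1 / δ)) ≤ (n : ℝ) →
        ∃ A : Set (Fin n → ERM.Example d), MeasurableSet A ∧
          ENNReal.ofReal (1 - δ) ≤ ERM.trainingDist μ Cov κ n A ∧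
          ∀ S ∈ A, ∃ w : EuclideanSpace ℝ (Fin d),
            ERM.IsUniqueMinimizer (ERM.empiricalLoss S) w ∧
            1 - ε ≤ ERM.cosSim w (Matrix.toEuclideanCLM (𝕜 := ℝ) Cov⁻¹ μ) := by
  intro c hc
  have hd : 0 < d := by
    rcases Nat.eq_zero_or_pos d with rfl | h
    · exact absurd (Subsingleton.elim μ 0) hμ
    · exact h
  have hd' : (1 : ℝ) ≤ d := by exact_mod_cast hd
  obtain ⟨l, hl, hlCov⟩ := ERM.exists_pos_forall_le_dotProduct_mulVec hCov
  set D : ℝ := Cov.trace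
  have hD : ∀ j, Cov j j ≤ D := fun j =>
    Finset.single_le_sum (f := fun j => Cov j j) (fun i _ => hCov.diag_pos.le) (Finset.mem_univ j)
  set h : ℝ := ‖Matrix.toEuclideanCLM (𝕜 := ℝ) Cov⁻¹ μ‖ with hh
  have hhpos : 0 < h := norm_pos_iff.2 (ERM.toEuclideanCLM_inv_ne_zero hCov hμ)
  -- The summands ensure `R ≥ 1`, `R ≥ 2‖μ‖` and a small truncation error, respectively.
  set R : ℝ := 1 + 2 * ‖μ‖ + 1536 * (d : ℝ) ^ 2 * Real.exp (D / 2) / l with hR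
  have hfrac : 0 ≤ 1536 * (d : ℝ) ^ 2 * Real.exp (D / 2) / l := by positivity
  have hμnn := norm_nonneg μ
  have hR1 : 1 ≤ R := by linarith
  have hRl : 768 * (d : ℝ) ^ 2 * Real.exp (D / 2) ≤ l / 2 * R := by
    have : 1536 * (d : ℝ) ^ 2 * Real.exp (D / 2) / l ≤ R := by linarith
    rw [div_le_iff₀ hl] at this
    linarith
  set C : ℝ := 2 * Real.exp (2 * ‖μ‖ + 2 * D) + Real.exp (4 * R ^ 2) with hCdef
  have hCpos : 0 < C := by positivity
  -- The three terms yield `s ≤ 1`, the strict gradient bound (`32` against `16`), and the moment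
  -- accuracy `l / (4κ)`.
  set a : ℝ := min 1 (min (l * h / (32 * d)) (l / (4 * d)))
  have ha : 0 < a := by positivity
  have ha1 : a ≤ 1 := min_le_left _ _
  have ha2 : d * a ≤ l * h / 32 := by
    have : a ≤ l * h / (32 * d) := (min_le_right _ _).trans (min_le_left _ _)
    rw [le_div_iff₀ (by positivity)] at this
    linarith
  have ha3 : d * a ≤ l / 4 := by
    have : a ≤ l / (4 * d) := (min_le_right _ _).trans (min_le_right _ _)
    rw [le_div_iff₀ (by positivity)] at this
    linarith
  -- The part `4hR` matches the curvature decay; the extra `1` supplies `e^{-κ} ≤ 1 / κ` for the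
  -- moment accuracy.
  set b : ℝ := 4 * h * R + 1 with hbdef
  have hb : 0 ≤ b := by positivity
  have hN : (1 : ℝ) ≤ 2 * (d + d ^ 2) := by nlinarith
  refine ⟨1 + (2 * b + |Real.log (8 * C * (1 + Real.log (2 * (d + d ^ 2))) / a ^ 2)|) / c,
    by positivity, fun κ hκ ε δ hε hδ n hn => ?_⟩
  have hprob := ERM.card_mul_exp_neg_le hb ha hCpos hN hc hκ hε hδ hn
  have hκ1 : 1 ≤ κ := le_trans (le_add_of_nonneg_right (by positivity)) hκ
  obtain ⟨hε0, hε1⟩ := hε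
  obtain ⟨hδ0, hδ1⟩ := hδ
  have hn0 : 0 < n := by
    have hlogε : 0 ≤ Real.log (1 / ε) := Real.log_nonneg (one_le_one_div hε0 hε1.le)
    have hlogδ : 0 ≤ Real.log (1 / δ) := Real.log_nonneg (one_le_one_div hδ0 hδ1.le)
    have : (0 : ℝ) < n := lt_of_lt_of_le (by positivity) hn
    exact_mod_cast this
  have hsplit : Real.exp (-b * κ) = Real.exp (-(4 * h * R * κ)) * Real.exp (-κ) := by
    rw [← Real.exp_add]
    congr 1
    rw [hbdef]
    ring
  have he1 : Real.exp (-(4 * h * R * κ)) ≤ 1 := Real.exp_le_one_iff.2 (by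
    have : 0 ≤ 4 * h * R * κ := by positivity
    linarith)
  have he2 : Real.exp (-κ) ≤ 1 / κ := by
    rw [Real.exp_neg, one_div]
    gcongr
    linarith [Real.add_one_le_exp κ]
  have he3 : Real.exp (-κ) ≤ 1 := Real.exp_le_one_iff.2 (by linarith)
  have heb : Real.exp (-b * κ) ≤ 1 := by
    rw [hsplit]
    exact mul_le_one₀ he1 (Real.exp_pos _).le he3
  obtain ⟨A, hA, hPA, hgood⟩ := ERM.exists_event_isUniqueMinimizer (n := n) (κ := κ)
    (s := a * Real.exp (-b * κ) * ε) (C := C) (ε := ε) hμ hCov hl hlCov hD hh hR1 (by linarith)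
    hRl hκ1 hε0 hε1 (by linarith [Real.exp_pos (4 * R ^ 2)])
    (by linarith [Real.exp_pos (2 * ‖μ‖ + 2 * D)]) (by positivity)
    (mul_le_one₀ (mul_le_one₀ ha1 (Real.exp_pos _).le heb) hε0.le hε1.le)
    (by
      calc d * (a * Real.exp (-b * κ) * ε)
          = d * a * (Real.exp (-(4 * h * R * κ)) * Real.exp (-κ)) * ε := by rw [hsplit]; ring
        _ ≤ l / 4 * (1 * (1 / κ)) * 1 := by gcongr
        _ = l / (4 * κ) := by field_simp)
    (by
      calc d * (a * Real.exp (-b * κ) * ε)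
          = d * a * (Real.exp (-(4 * h * R * κ)) * Real.exp (-κ)) * ε := by rw [hsplit]; ring
        _ ≤ l * h / 32 * (Real.exp (-(4 * h * R * κ)) * 1) * ε := by gcongr
        _ < l * h * ε / 16 * Real.exp (-(4 * h * R * κ)) := by
          have : 0 < l * h * ε * Real.exp (-(4 * h * R * κ)) := by positivity
          linarith) hn0
  refine ⟨A, hA, le_trans (ENNReal.ofReal_le_ofReal ?_) hPA, hgood⟩
  linarith
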